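/- Let $N>1$ and $d\ge 1$ be integers, ${\cal S}=\{1,\dots,N\}$, and let $v_1,\dots,v_N\in\mathbb{R}^d$ satisfy $\dim\operatorname{span}\{v_1,\dots,v_N\}=d$. For $i\ne j$ let $a_{ij}:\mathbb{R}^d\to[0,\infty)$ be continuous. Let $(X(t),L(t))_{t\ge 0}$ be the Markov process on ${\cal S}\times\mathbb{R}^d$ in which $X$ is a pure jump process that jumps from $i$ to $j\neq i$ at rate $a_{ij}(L(t))$, and $$L(t)=L(0)+\sum_{j\in{\cal S}}v_j\,L_j(t),\qquad L_j(t)=\mathrm{Leb}\{s\in[0,t]:X(s)=j\};$$ thus its generator is $Af(j,l)=v_j\cdot\nabla_l f(j,l)+\sum_{i\ne j}a_{ji}(l)[f(i,l)-f(j,l)]$. Let $p_1,\dots,p_N>0$ with $\sum_j p_j=1$, and let $g:\mathbb{R}^d\to[0,\infty)$ be continuous with $\int_{\mathbb{R}^d}g(l)\,dl=1$. Then the probability measure $p_j g(l)\,dj\,dl$ on ${\cal S}\times\mathbb{R}^d$ is invariant for $(X,L)$ if and only if $g$ is differentiable and $$-p_j v_j\cdot\nabla g(l)+\sum_{i\ne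 j}\bigl[p_i a_{ij}(l)g(l)-p_j a_{ji}(l)g(l)\bigr]=0,\qquad j=1,\dots,N,\ l\in\mathbb{R}^d,$$ that is, $A^*h\equiv 0$ for $h(j,l)=p_jg(l)$, where $A^*$ is the formal adjoint $A^*h(j,l)=-v_j\cdot\nabla_l h(j,l)+\sum_{i\neq j}[a_{ij}(l)h(i,l)-a_{ji}(l)h(j,l)]$. -/

import Mathlib

open MeasureTheory
open scoped ENNReal

namespace InertDrift

noncomputable section

/-- The state space of `L`. -/
abbrev Vec (d : ℕ) : Type := EuclideanSpace ℝ (Fin d)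

variable {N d : ℕ}

/-- The noise driving the process: for every `n`, one exponential threshold for each of the `N`
possible targets of the `(n+1)`-st jump. -/
abbrev Noise (N : ℕ) : Type := ℕ → Fin N → ℝ

/-- The law of the noise: all thresholds are independent standard exponential variables. -/
def noiseLaw (N : ℕ) : Measure (Noise N) :=
  Measure.infinitePi fun _ : ℕ => Measure.pi fun _ : Fin N => ProbabilityTheory.expMeasure 1

/-- Suppose that `X` has just entered the state `j` while `L` is at `l`. As long as `X` stays at
`j`, the position of `L` after a further time `u` is `l + u • v j`, and the jump to `i ≠ j` is
attempted at the rate `a j i (l + u • v j)`. This is the waiting time for that attempt, i.e. the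
first `s` at which the rate accumulated over `[0, s]` reaches the exponential threshold `ξ`
(it is `∞` if that never happens), so that it exceeds `s` with probability
`exp (- ∫ u in 0..s, a j i (l + u • v j))`. -/
def clock (a : Fin N → Fin N → Vec d → ℝ) (v : Fin N → Vec d) (j : Fin N) (l : Vec d)
    (i : Fin N) (ξ : ℝ) : ℝ≥0∞ :=
  if i = j then ∞
  else ⨅ (s : ℝ) (_ : 0 ≤ s ∧ ξ ≤ ∫ u in (0 : ℝ)..s, a j i (l + u • v j)), ENNReal.ofReal s

/-- The time that `X` spends at `j` before it jumps: the first of the waiting times. -/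
def hold (a : Fin N → Fin N → Vec d → ℝ) (v : Fin N → Vec d) (j : Fin N) (l : Vec d)
    (ξ : Fin N → ℝ) : ℝ≥0∞ :=
  ⨅ i, clock a v j l i (ξ i)

theorem exists_clock_eq_hold (a : Fin N → Fin N → Vec d → ℝ) (v : Fin N → Vec d) (j : Fin N)
    (l : Vec d) (ξ : Fin N → ℝ) : ∃ i, clock a v j l i (ξ i) = hold a v j l ξ :=
  haveI : Nonempty (Fin N) := ⟨j⟩
  exists_eq_ciInf_of_finite

/-- The target of the jump: the state whose waiting time is the first one. (Ties between finite
waiting times have probability zero.) -/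
def target (a : Fin N → Fin N → Vec d → ℝ) (v : Fin N → Vec d) (j : Fin N) (l : Vec d)
    (ξ : Fin N → ℝ) : Fin N :=
  (exists_clock_eq_hold a v j l ξ).choose

/-- The triple (time of the `n`-th jump, state of `X` after it, position of `L` at that time) for
the process started from `x`. The time is `∞` if there are fewer than `n` jumps, in which case the
other two entries are not used. -/
def jumpChain (a : Fin N → Fin N → Vec d → ℝ) (v : Fin N → Vec d) (x : Fin N × Vec d)
    (ω : Noise N) : ℕ → ℝ≥0∞ × Fin N × Vec d
  | 0 => (0, x.1, x.2)
  | n + 1 =>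
    let z := jumpChain a v x ω n
    let τ := hold a v z.2.1 z.2.2 (ω n)
    (z.1 + τ, target a v z.2.1 z.2.2 (ω n), z.2.2 + τ.toReal • v z.2.1)

/-- The number of jumps in `[0, t]` (finite almost surely). -/
def jumpCount (a : Fin N → Fin N → Vec d → ℝ) (v : Fin N → Vec d) (x : Fin N × Vec d)
    (t : ℝ) (ω : Noise N) : ℕ :=
  sSup {n : ℕ | (jumpChain a v x ω n).1 ≤ ENNReal.ofReal t}

/-- The component `X (t)` of the process started from `x`, for `t ≥ 0`. -/
def X (a : Fin N → Fin N → Vec d → ℝ) (v : Fin N → Vec d) (x : Fin N × Vec d)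
    (t : ℝ) (ω : Noise N) : Fin N :=
  (jumpChain a v x ω (jumpCount a v x t ω)).2.1

/-- The time `L_j (t)` spent by `X` in the state `j` during `[0, t]`. -/
def occupationTime (a : Fin N → Fin N → Vec d → ℝ) (v : Fin N → Vec d) (x : Fin N × Vec d)
    (j : Fin N) (t : ℝ) (ω : Noise N) : ℝ :=
  (volume {s : ℝ | s ∈ Set.Icc 0 t ∧ X a v x s ω = j}).toReal

/-- The component `L (t)` of the process started from `x`, for `t ≥ 0`. -/
def L (a : Fin N → Fin N → Vec d → ℝ) (v : Fin N → Vec d) (x : Fin N × Vec d)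
    (t : ℝ) (ω : Noise N) : Vec d :=
  x.2 + ∑ j, occupationTime a v x j t ω • v j

/-- The law of `(X (t), L (t))` when `(X (0), L (0))` has the law `π` and is independent of the
noise. -/
def lawAt (a : Fin N → Fin N → Vec d → ℝ) (v : Fin N → Vec d) (π : Measure (Fin N × Vec d))
    (t : ℝ) : Measure (Fin N × Vec d) :=
  (π.prod (noiseLaw N)).map fun z => (X a v z.1 t z.2, L a v z.1 t z.2)

/-- `π` is an invariant measure of the process `(X, L)`. -/
def IsInvariant (a : Fin N → Fin N → Vec d → ℝ) (v : Fin N → Vec d)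
    (π : Measure (Fin N × Vec d)) : Prop :=
  ∀ t : ℝ, 0 ≤ t → lawAt a v π t = π

/-- The measure `p_j g(l) dj dl` on `{1, …, N} × ℝ^d`. -/
def productMeasure (p : Fin N → ℝ) (g : Vec d → ℝ) : Measure (Fin N × Vec d) :=
  (∑ j, ENNReal.ofReal (p j) • Measure.dirac j).prod
    (volume.withDensity fun l => ENNReal.ofReal (g l))

end

end InertDrift

namespace InertDrift

noncomputable section

variable {N d : ℕ}

open Filter Topology ProbabilityTheory Set

/-! No generator or core is used: stationarity is first turned into an integral equation for the
density. Let `killedOp` (K_t) be the semigroup killed at the first jump and `jumpOp` (B) the jump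
part of the generator. Splitting at the last jump before t, the expectation of f on exactly n + 1
jumps is the integral over r in (0, t] of the expectation of B K_{t-r} f at time r on exactly n
jumps (`JumpRates.jumpSemigroup_succ`). There is no explosion (`JumpRates.ae_exists_lt_jumpChain`),
so summing over n recovers the law at time t (`JumpRates.lintegral_lawAt`).

For an invariant π the sum gives π f = π K_t f + ∫ π B K_{t-r} f dr. Conversely, if π satisfies this
identity, induction on n bounds the contribution of fewer than n jumps by π f. Hence the law at time
t is at most π, and two probability measures so ordered coincide.

If π has a continuous density h, moving the translations from f onto h turns the identity into the
mild equation `mildDensity` = h, which holds pointwise by continuity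
(`JumpRates.isInvariant_iff_mildDensity_eq`). By variation of constants along each line of direction
v_j, it is equivalent to a linear differential equation for h_j on that line
(`JumpRates.mildDensity_eq_iff`).

For h_j = p_j g with p_j > 0, this equation gives g a derivative in every direction v_j, continuous
because the other terms of the equation are. As the v_j span, g is differentiable
(`differentiable_of_hasDerivAt_line`), and the equations on the lines are exactly A^*h = 0. -/

/-! ### Jump rates and survival probabilities -/

/-- The standing assumptions on the jump rates. -/
structure JumpRates (a : Fin N → Fin N → Vec d → ℝ) : Prop where
  nonneg : ∀ i j, i ≠ j → ∀ l, 0 ≤ a i j l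
  cont : ∀ i j, i ≠ j → Continuous (a i j)

/-- The rate of the jumps from `j` to `i`, with the convention that it vanishes for `i = j`. -/
def rate (a : Fin N → Fin N → Vec d → ℝ) (j i : Fin N) (l : Vec d) : ℝ :=
  if i = j then 0 else a j i l

/-- The rate of the jumps from `j` to `i` accumulated in time `s` along the line with
direction `v j`. -/
def cumRate (a : Fin N → Fin N → Vec d → ℝ) (v : Fin N → Vec d) (j i : Fin N) (l : Vec d)
    (s : ℝ) : ℝ :=
  ∫ u in (0 : ℝ)..s, rate a j i (l + u • v j)

/-- The probability that there is no jump up to time `s` when starting from `(j, l)`. -/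
def survival (a : Fin N → Fin N → Vec d → ℝ) (v : Fin N → Vec d) (j : Fin N) (l : Vec d)
    (s : ℝ) : ℝ :=
  Real.exp (-∑ i, cumRate a v j i l s)

variable {a : Fin N → Fin N → Vec d → ℝ} {v : Fin N → Vec d}

theorem rate_self (j : Fin N) (l : Vec d) : rate a j j l = 0 := by simp [rate]

theorem JumpRates.rate_nonneg (ha : JumpRates a) (j i : Fin N) (l : Vec d) :
    0 ≤ rate a j i l := by
  unfold rate
  split_ifs with h
  · exact le_rfl
  · exact ha.nonneg j i (Ne.symm h) l

theorem JumpRates.continuous_rate (ha : JumpRates a) (j i : Fin N) :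
    Continuous (rate a j i) := by
  unfold rate
  by_cases h : i = j
  · simpa [h] using continuous_const
  · simpa [h] using ha.cont j i (Ne.symm h)

theorem JumpRates.continuous_cumRate (ha : JumpRates a) (j i : Fin N) :
    Continuous fun q : Vec d × ℝ => cumRate a v j i q.1 q.2 := by
  unfold cumRate
  refine intervalIntegral.continuous_parametric_intervalIntegral_of_continuous
    (f := fun (q : Vec d × ℝ) u => rate a j i (q.1 + u • v j)) ?_ continuous_snd
  exact (ha.continuous_rate j i).comp (by fun_prop)

theorem JumpRates.continuous_cumRate_time (ha : JumpRates a) (j i : Fin N) (l : Vec d) :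
    Continuous (cumRate a v j i l) :=
  (ha.continuous_cumRate j i).comp (Continuous.prodMk_right l)

theorem JumpRates.continuous_survival (ha : JumpRates a) (j : Fin N) :
    Continuous fun q : Vec d × ℝ => survival a v j q.1 q.2 := by
  unfold survival
  exact Real.continuous_exp.comp
    (continuous_finsetSum _ fun i _ => ha.continuous_cumRate j i).neg

theorem cumRate_zero (j i : Fin N) (l : Vec d) : cumRate a v j i l 0 = 0 := by
  simp [cumRate]

theorem JumpRates.continuous_rate_line (ha : JumpRates a) (j i : Fin N) (l : Vec d) :
    Continuous fun u : ℝ => rate a j i (l + u • v j) :=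
  (ha.continuous_rate j i).comp (by fun_prop)

theorem JumpRates.hasDerivAt_cumRate (ha : JumpRates a) (j i : Fin N) (l : Vec d) (s : ℝ) :
    HasDerivAt (cumRate a v j i l) (rate a j i (l + s • v j)) s :=
  (ha.continuous_rate_line j i l).integral_hasStrictDerivAt 0 s |>.hasDerivAt

theorem JumpRates.cumRate_mono (ha : JumpRates a) (j i : Fin N) (l : Vec d) :
    Monotone (cumRate a v j i l) :=
  monotone_of_deriv_nonneg (fun s => (ha.hasDerivAt_cumRate j i l s).differentiableAt)
    fun s => by rw [(ha.hasDerivAt_cumRate j i l s).deriv]; exact ha.rate_nonneg _ _ _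

theorem JumpRates.cumRate_nonneg (ha : JumpRates a) (j i : Fin N) (l : Vec d) {s : ℝ}
    (hs : 0 ≤ s) : 0 ≤ cumRate a v j i l s := by
  rw [← cumRate_zero (a := a) (v := v) j i l]
  exact ha.cumRate_mono j i l hs

theorem survival_pos (j : Fin N) (l : Vec d) (s : ℝ) : 0 < survival a v j l s :=
  Real.exp_pos _

theorem survival_zero (j : Fin N) (l : Vec d) : survival a v j l 0 = 1 := by
  simp [survival, cumRate_zero]

theorem JumpRates.survival_le_one (ha : JumpRates a) (j : Fin N) (l : Vec d) {s : ℝ}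
    (hs : 0 ≤ s) : survival a v j l s ≤ 1 := by
  rw [survival, Real.exp_le_one_iff, neg_nonpos]
  exact Finset.sum_nonneg fun i _ => ha.cumRate_nonneg j i l hs

/-! ### Exponential thresholds and a single clock -/

instance : IsProbabilityMeasure (expMeasure 1) := isProbabilityMeasure_expMeasure one_pos

theorem expMeasure_Iic {x : ℝ} (hx : 0 ≤ x) :
    expMeasure 1 (Iic x) = ENNReal.ofReal (1 - Real.exp (-x)) := by
  rw [← ofReal_cdf, cdf_expMeasure_eq one_pos, if_pos hx, one_mul]

theorem expMeasure_Ioi {x : ℝ} (hx : 0 ≤ x) :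
    expMeasure 1 (Ioi x) = ENNReal.ofReal (Real.exp (-x)) := by
  rw [← compl_Iic, prob_compl_eq_one_sub measurableSet_Iic, expMeasure_Iic hx,
    ← ENNReal.ofReal_one, ← ENNReal.ofReal_sub _ (by simpa using hx)]
  congr 1; ring

instance : NullSingletonClass (expMeasure 1) := by
  unfold expMeasure gammaMeasure
  infer_instance

theorem ae_expMeasure_pos : ∀ᵐ x ∂expMeasure 1, 0 < x := by
  have h : expMeasure 1 (Iic 0) = 0 := by rw [expMeasure_Iic le_rfl]; simp
  rw [ae_iff]
  convert! h using 2
  ext x; simp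

theorem clock_self (j : Fin N) (l : Vec d) (ξ : ℝ) : clock a v j l j ξ = ∞ := by
  simp [clock]

/-- The infimum is attained: if the rate accumulated at s is below ξ, then by continuity it is so at
some t > s, and by monotonicity no time before t is admissible. -/
theorem JumpRates.clock_le_iff (ha : JumpRates a) {j i : Fin N} (hij : i ≠ j) (l : Vec d)
    (ξ : ℝ) {s : ℝ} (hs : 0 ≤ s) :
    clock a v j l i ξ ≤ ENNReal.ofReal s ↔ ξ ≤ cumRate a v j i l s := by
  have hcum : ∀ s, ∫ u in (0 : ℝ)..s, a j i (l + u • v j) = cumRate a v j i l s := by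
    intro s; simp [cumRate, rate, hij]
  simp only [clock, if_neg hij, hcum]
  constructor
  · intro h
    by_contra! hlt
    have hev : ∀ᶠ t in 𝓝[>] s, cumRate a v j i l t < ξ :=
      nhdsWithin_le_nhds ((ha.continuous_cumRate_time j i l).continuousAt.eventually_lt
        continuousAt_const hlt)
    obtain ⟨t, ht, hst⟩ := (hev.and self_mem_nhdsWithin).exists
    have hst' : s < t := hst
    have : ENNReal.ofReal t ≤ ENNReal.ofReal s := by
      refine le_trans ?_ h
      refine le_iInf₂ fun r hr => ENNReal.ofReal_le_ofReal ?_
      by_contra! hrt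
      exact absurd (hr.2.trans (ha.cumRate_mono j i l hrt.le)) (not_le.2 ht)
    rw [ENNReal.ofReal_le_ofReal_iff hs] at this
    linarith
  · intro h
    exact iInf₂_le s ⟨hs, h⟩

theorem JumpRates.measurable_clock (ha : JumpRates a) (i : Fin N) :
    Measurable fun q : Fin N × Vec d × ℝ => clock a v q.1 q.2.1 i q.2.2 := by
  refine measurable_from_prod_countable_right fun j => ?_
  by_cases hij : i = j
  · subst hij
    simp [clock_self]
  refine measurable_of_Iic fun b => ?_
  induction b with
  | top => simp
  | coe b =>
    have : (fun q : Vec d × ℝ => clock a v j q.1 i q.2) ⁻¹' Iic (b : ℝ≥0∞)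
        = {q | q.2 ≤ cumRate a v j i q.1 b} := by
      ext q
      have := ha.clock_le_iff (v := v) hij q.1 q.2 b.coe_nonneg
      rwa [ENNReal.ofReal_coe_nnreal] at this
    change MeasurableSet ((fun q : Vec d × ℝ => clock a v j q.1 i q.2) ⁻¹' Iic (b : ℝ≥0∞))
    rw [this]
    refine measurableSet_le measurable_snd (Continuous.measurable ?_)
    exact (ha.continuous_cumRate j i).comp
      (f := fun q : Vec d × ℝ => (q.1, (b : ℝ))) (by fun_prop)

theorem JumpRates.measurable_clock_noise (ha : JumpRates a) (j i : Fin N) (l : Vec d) :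
    Measurable (clock a v j l i) :=
  (ha.measurable_clock i).comp (f := fun ξ : ℝ => (j, l, ξ)) (by fun_prop)

/-- The law of a single clock. -/
theorem JumpRates.lintegral_clock (ha : JumpRates a) (j i : Fin N) (l : Vec d)
    {φ : ℝ → ℝ≥0∞} (hφ : Measurable φ) :
    ∫⁻ ξ, (if clock a v j l i ξ = ∞ then 0 else φ (clock a v j l i ξ).toReal) ∂expMeasure 1
      = ∫⁻ u in Ioi 0, ENNReal.ofReal (rate a j i (l + u • v j)
          * Real.exp (-cumRate a v j i l u)) * φ u := by
  by_cases hij : i = j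
  · subst hij
    simp [clock_self, rate_self]
  set c := clock a v j l i with hc
  have hcm : Measurable c := ha.measurable_clock_noise j i l
  have hfin : MeasurableSet {ξ | c ξ ≠ ∞} := hcm (measurableSet_singleton _).compl
  set w : ℝ → ℝ := fun u => rate a j i (l + u • v j) * Real.exp (-cumRate a v j i l u) with hw
  have hwc : Continuous w :=
    (ha.continuous_rate_line j i l).mul
      (Real.continuous_exp.comp (ha.continuous_cumRate_time j i l).neg)
  have hw0 : ∀ u, 0 ≤ w u := fun u => mul_nonneg (ha.rate_nonneg _ _ _) (Real.exp_pos _).le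
  -- Finite measures are compared on half-lines. Both may have mass less than 1, since the clock may
  -- never ring.
  have key : ((expMeasure 1).restrict {ξ | c ξ ≠ ∞}).map (fun ξ => (c ξ).toReal)
      = (volume.restrict (Ioi 0)).withDensity fun u => ENNReal.ofReal (w u) := by
    have hmt : Measurable fun ξ => (c ξ).toReal := hcm.ennreal_toReal
    have : IsFiniteMeasure (((expMeasure 1).restrict {ξ | c ξ ≠ ∞}).map
      (fun ξ => (c ξ).toReal)) := inferInstance
    refine Measure.ext_of_Iic _ _ fun s => ?_
    rw [Measure.map_apply hmt measurableSet_Iic,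
      Measure.restrict_apply (hmt measurableSet_Iic),
      withDensity_apply _ measurableSet_Iic, Measure.restrict_restrict measurableSet_Iic]
    rcases lt_or_ge s 0 with hs | hs
    · have h1 : (fun ξ => (c ξ).toReal) ⁻¹' Iic s ∩ {ξ | c ξ ≠ ∞} = ∅ := by
        ext ξ
        simp only [mem_inter_iff, mem_preimage, mem_Iic, mem_empty_iff_false, iff_false, not_and]
        intro h
        exact absurd (ENNReal.toReal_nonneg.trans h) (not_le.2 hs)
      have h2 : Iic s ∩ Ioi (0 : ℝ) = ∅ := by
        ext u; simp only [mem_inter_iff, mem_Iic, mem_Ioi, mem_empty_iff_false, iff_false]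
        intro h; linarith [h.1, h.2]
      simp [h1, h2]
    · have h1 : (fun ξ => (c ξ).toReal) ⁻¹' Iic s ∩ {ξ | c ξ ≠ ∞} = Iic (cumRate a v j i l s) := by
        ext ξ
        rw [mem_inter_iff, mem_preimage, mem_Iic, mem_Iic, ← ha.clock_le_iff hij l ξ hs]
        constructor
        · rintro ⟨h, h'⟩
          exact (ENNReal.le_ofReal_iff_toReal_le h' hs).2 h
        · intro h
          have h' : c ξ ≠ ∞ := (h.trans_lt ENNReal.ofReal_lt_top).ne
          exact ⟨(ENNReal.le_ofReal_iff_toReal_le h' hs).1 h, h'⟩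
      have h2 : Iic s ∩ Ioi (0 : ℝ) = Ioc 0 s := by
        ext u; simp [and_comm]
      rw [h1, h2, expMeasure_Iic (ha.cumRate_nonneg j i l hs),
        ← ofReal_integral_eq_lintegral_ofReal
          ((hwc.integrableOn_Icc (a := 0) (b := s)).mono_set Ioc_subset_Icc_self)
          (ae_of_all _ hw0),
        ← intervalIntegral.integral_of_le hs]
      congr 1
      rw [intervalIntegral.integral_eq_sub_of_hasDerivAt
        (f := fun u => -Real.exp (-cumRate a v j i l u))]
      · simp [cumRate_zero]; ring
      · intro u _
        convert! ((ha.hasDerivAt_cumRate j i l u).neg.exp).neg using 1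
        simp only [hw, Pi.neg_apply]; ring
      · exact hwc.intervalIntegrable _ _
  calc ∫⁻ ξ, (if c ξ = ∞ then 0 else φ (c ξ).toReal) ∂expMeasure 1
      = ∫⁻ ξ in {ξ | c ξ ≠ ∞}, φ (c ξ).toReal ∂expMeasure 1 := by
        rw [← lintegral_indicator hfin]
        refine lintegral_congr fun ξ => ?_
        by_cases h : c ξ = ∞ <;> simp [indicator, h]
    _ = ∫⁻ u, φ u ∂((volume.restrict (Ioi 0)).withDensity fun u => ENNReal.ofReal (w u)) := by
        rw [← key, lintegral_map hφ hcm.ennreal_toReal]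
    _ = _ := by
        rw [lintegral_withDensity_eq_lintegral_mul _ hwc.measurable.ennreal_ofReal hφ]
        rfl

/-! ### Joint law of holding time and target -/

/-- The law of the thresholds for one jump. -/
abbrev thresholdLaw (N : ℕ) : Measure (Fin N → ℝ) := Measure.pi fun _ : Fin N => expMeasure 1

/-- By Fubini: given the coordinate i, the independent coordinate k has no atoms. This excludes ties
between clocks. -/
theorem ae_thresholdLaw_ne {i k : Fin N} (hik : k ≠ i) {G : ℝ → ℝ} (hG : Measurable G) :
    ∀ᵐ ξ ∂thresholdLaw N, ξ k ≠ G (ξ i) := by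
  cases N with
  | zero => exact i.elim0
  | succ n =>
    obtain ⟨k, rfl⟩ := Fin.exists_succAbove_eq hik
    have hmp := measurePreserving_piFinSuccAbove (fun _ : Fin (n + 1) => expMeasure 1) i
    have hae : ∀ᵐ q ∂((expMeasure 1).prod (thresholdLaw n)), q.2 k ≠ G q.1 := by
      refine (Measure.ae_prod_iff_ae_ae ?_).2 (ae_of_all _ fun x => ?_)
      · exact (measurableSet_eq_fun (by fun_prop) (hG.comp measurable_fst)).compl
      · exact Measure.ae_eval_ne (fun _ : Fin n => expMeasure 1) k (G x)
    exact hmp.quasiMeasurePreserving.ae hae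

theorem ae_thresholdLaw_pos : ∀ᵐ ξ ∂thresholdLaw N, ∀ i, 0 < ξ i := by
  refine ae_all_iff.2 fun i => ?_
  exact (measurePreserving_eval (fun _ : Fin N => expMeasure 1) i).quasiMeasurePreserving.ae
    ae_expMeasure_pos

theorem hold_le_clock (j : Fin N) (l : Vec d) (ξ : Fin N → ℝ) (i : Fin N) :
    hold a v j l ξ ≤ clock a v j l i (ξ i) := iInf_le _ i

theorem clock_target (j : Fin N) (l : Vec d) (ξ : Fin N → ℝ) :
    clock a v j l (target a v j l ξ) (ξ (target a v j l ξ)) = hold a v j l ξ :=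
  (exists_clock_eq_hold a v j l ξ).choose_spec

/-- Positivity of ξ makes the case i = j fit: the clock is infinite and the accumulated rate is 0.
-/
theorem JumpRates.lt_clock_iff (ha : JumpRates a) (j i : Fin N) (l : Vec d)
    {ξ : ℝ} (hξ : 0 < ξ) {s : ℝ} (hs : 0 ≤ s) :
    ENNReal.ofReal s < clock a v j l i ξ ↔ cumRate a v j i l s < ξ := by
  by_cases hij : i = j
  · subst hij
    simp [clock_self, cumRate, rate_self, hξ]
  · rw [← not_le, ha.clock_le_iff hij l ξ hs, not_le]

/-- Without ties, the choice hidden in `target` does not matter. Once ξ i is fixed, the right-hand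
side confines the other thresholds to a box, whose probability is a product. -/
theorem JumpRates.ae_target_eq_iff (ha : JumpRates a) (j : Fin N) (l : Vec d) :
    ∀ᵐ ξ ∂thresholdLaw N, ∀ i, (hold a v j l ξ ≠ ∞ ∧ target a v j l ξ = i) ↔
      (clock a v j l i (ξ i) ≠ ∞ ∧
        ∀ k, k ≠ i → cumRate a v j k l (clock a v j l i (ξ i)).toReal < ξ k) := by
  have hne : ∀ᵐ ξ ∂thresholdLaw N, ∀ i k, k ≠ i →
      ξ k ≠ cumRate a v j k l (clock a v j l i (ξ i)).toReal := by
    simp_rw [ae_all_iff]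
    intro i k hik
    exact ae_thresholdLaw_ne hik (G := fun x => cumRate a v j k l (clock a v j l i x).toReal)
      ((ha.continuous_cumRate_time j k l).measurable.comp
        (ha.measurable_clock_noise j i l).ennreal_toReal)
  filter_upwards [hne, ae_thresholdLaw_pos] with ξ hne hpos i
  constructor
  · rintro ⟨hfin, rfl⟩
    set i := target a v j l ξ with hi
    have hci : clock a v j l i (ξ i) = hold a v j l ξ := clock_target j l ξ
    refine ⟨hci ▸ hfin, fun k hk => ?_⟩
    by_contra! hle
    -- With strict inequality, the clock of k has already rung before s, so s is not the minimum.
    have hlt := lt_of_le_of_ne hle (hne i k hk)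
    rw [hci] at hlt
    set s := (hold a v j l ξ).toReal with hs
    have hs0 : 0 < s := by
      refine lt_of_le_of_ne ENNReal.toReal_nonneg fun h0 => ?_
      rw [← h0, cumRate_zero] at hlt
      exact absurd hlt (not_lt.2 (hpos k).le)
    have hev : ∀ᶠ t in 𝓝[<] s, ξ k < cumRate a v j k l t :=
      nhdsWithin_le_nhds (continuousAt_const.eventually_lt
        (ha.continuous_cumRate_time j k l).continuousAt hlt)
    obtain ⟨t, ⟨ht, hts⟩, ht0⟩ := ((hev.and self_mem_nhdsWithin).and
      (nhdsWithin_le_nhds (lt_mem_nhds hs0))).exists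
    have hts' : t < s := hts
    have h1 : clock a v j l k (ξ k) ≤ ENNReal.ofReal t := by
      rw [← not_lt, ha.lt_clock_iff j k l (hpos k) (le_of_lt ht0)]
      exact not_lt.2 ht.le
    have h2 : ENNReal.ofReal s ≤ ENNReal.ofReal t := by
      rw [hs, ENNReal.ofReal_toReal hfin]
      exact (hold_le_clock j l ξ k).trans h1
    rw [ENNReal.ofReal_le_ofReal_iff (le_of_lt ht0)] at h2
    linarith
  · rintro ⟨hfin, hlt⟩
    have hk : ∀ k, k ≠ i → clock a v j l i (ξ i) < clock a v j l k (ξ k) := by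
      intro k hk
      have := (ha.lt_clock_iff j k l (hpos k) ENNReal.toReal_nonneg).2 (hlt k hk)
      rwa [ENNReal.ofReal_toReal hfin] at this
    have htar : target a v j l ξ = i := by
      by_contra hne'
      exact absurd ((clock_target j l ξ).trans_le (hold_le_clock j l ξ i))
        (not_le.2 (hk _ hne'))
    refine ⟨?_, htar⟩
    rw [← clock_target j l ξ, htar]
    exact hfin

/-- The joint law of the holding time and of the target of the next jump. -/
theorem JumpRates.lintegral_hold_target (ha : JumpRates a) (j : Fin N) (l : Vec d)
    {φ : ℝ → Fin N → ℝ≥0∞} (hφ : ∀ i, Measurable fun u => φ u i) :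
    ∫⁻ ξ, (if hold a v j l ξ = ∞ then 0 else φ (hold a v j l ξ).toReal (target a v j l ξ))
        ∂thresholdLaw N
      = ∑ i, ∫⁻ u in Ioi 0,
          ENNReal.ofReal (rate a j i (l + u • v j) * survival a v j l u) * φ u i := by
  classical
  set F : Fin N → (Fin N → ℝ) → ℝ≥0∞ := fun i ξ =>
    if clock a v j l i (ξ i) ≠ ∞ ∧
        ∀ k, k ≠ i → cumRate a v j k l (clock a v j l i (ξ i)).toReal < ξ k
      then φ (clock a v j l i (ξ i)).toReal i else 0 with hF
  have hcl : ∀ i, Measurable fun ξ : Fin N → ℝ => clock a v j l i (ξ i) := fun i =>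
    (ha.measurable_clock_noise j i l).comp (measurable_pi_apply i)
  have hFm : ∀ i, Measurable (F i) := by
    intro i
    refine Measurable.ite ?_ ((hφ i).comp (hcl i).ennreal_toReal) measurable_const
    refine ((hcl i) (measurableSet_singleton _).compl).inter ?_
    have : {ξ : Fin N → ℝ | ∀ k, k ≠ i →
        cumRate a v j k l (clock a v j l i (ξ i)).toReal < ξ k}
        = ⋂ (k) (_ : k ≠ i), {ξ | cumRate a v j k l (clock a v j l i (ξ i)).toReal < ξ k} := by
      ext ξ; simp
    change MeasurableSet {ξ : Fin N → ℝ | ∀ k, k ≠ i →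
        cumRate a v j k l (clock a v j l i (ξ i)).toReal < ξ k}
    rw [this]
    exact MeasurableSet.iInter fun k => MeasurableSet.iInter fun _ => measurableSet_lt
      ((ha.continuous_cumRate_time j k l).measurable.comp (hcl i).ennreal_toReal)
      (measurable_pi_apply k)
  have hsum : ∀ᵐ ξ ∂thresholdLaw N,
      (if hold a v j l ξ = ∞ then 0 else φ (hold a v j l ξ).toReal (target a v j l ξ))
        = ∑ i, F i ξ := by
    filter_upwards [ha.ae_target_eq_iff (v := v) j l] with ξ hξ
    have : ∀ i, F i ξ = if target a v j l ξ = i then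
        (if hold a v j l ξ = ∞ then 0 else φ (hold a v j l ξ).toReal (target a v j l ξ))
        else 0 := by
      intro i
      simp only [hF]
      rw [if_congr (hξ i).symm rfl rfl]
      by_cases h1 : target a v j l ξ = i
      · subst h1
        by_cases h2 : hold a v j l ξ = ∞ <;> simp [h2, clock_target]
      · simp [h1]
    simp [this]
  rw [lintegral_congr_ae hsum, lintegral_finsetSum _ fun i _ => hFm i]
  refine Finset.sum_congr rfl fun i _ => ?_
  cases N with
  | zero => exact i.elim0
  | succ n =>
    have hmp := measurePreserving_piFinSuccAbove (fun _ : Fin (n + 1) => expMeasure 1) i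
    have hFs : Measurable fun q => F i ((MeasurableEquiv.piFinSuccAbove (fun _ => ℝ) i).symm q) :=
      (hFm i).comp (MeasurableEquiv.measurable _)
    -- Fubini with the threshold of the winning clock outermost. The other clocks contribute their
    -- survival probabilities, which complete the exponential of clock i to `survival`.
    have h1 : ∫⁻ ξ, F i ξ ∂thresholdLaw (n + 1)
        = ∫⁻ x, ∫⁻ y, F i (i.insertNth x y) ∂thresholdLaw n ∂expMeasure 1 := by
      rw [← hmp.symm.lintegral_comp (hFm i), lintegral_prod _ hFs.aemeasurable]
      rfl
    have h2 : ∀ x, ∫⁻ y, F i (i.insertNth x y) ∂thresholdLaw n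
        = if clock a v j l i x = ∞ then 0 else
          (fun u => φ u i * ENNReal.ofReal (Real.exp (-∑ k, cumRate a v j (i.succAbove k) l u)))
            (clock a v j l i x).toReal := by
      intro x
      by_cases hx : clock a v j l i x = ∞
      · simp [hF, hx]
      · simp only [hx, if_false]
        set s := (clock a v j l i x).toReal with hs
        have hs0 : 0 ≤ s := ENNReal.toReal_nonneg
        have : ∀ y : Fin n → ℝ, F i (i.insertNth x y) =
            (Set.pi univ fun k => Ioi (cumRate a v j (i.succAbove k) l s)).indicator
              (fun _ => φ s i) y := by
          intro y
          simp only [hF, indicator, Fin.forall_iff_succAbove i, Fin.insertNth_apply_same,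
            Fin.insertNth_apply_succAbove]
          simp [Set.mem_pi, ← hs, Fin.succAbove_ne, hx]
        simp_rw [this]
        rw [lintegral_indicator_const (MeasurableSet.univ_pi fun k => measurableSet_Ioi),
          Measure.pi_pi]
        congr 1
        rw [← Finset.sum_neg_distrib, Real.exp_sum,
          ENNReal.ofReal_prod_of_nonneg fun k _ => (Real.exp_pos _).le]
        exact Finset.prod_congr rfl fun k _ => expMeasure_Ioi (ha.cumRate_nonneg _ _ _ hs0)
    have hψ : Measurable fun u => φ u i * ENNReal.ofReal
        (Real.exp (-∑ k, cumRate a v j (i.succAbove k) l u)) := by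
      refine (hφ i).mul (Measurable.ennreal_ofReal (Continuous.measurable ?_))
      exact Real.continuous_exp.comp
        (continuous_finsetSum _ fun k _ => ha.continuous_cumRate_time _ _ _).neg
    rw [h1, lintegral_congr h2, ha.lintegral_clock j i l hψ]
    refine setLIntegral_congr_fun measurableSet_Ioi fun u _ => ?_
    have hsurv : survival a v j l u = Real.exp (-cumRate a v j i l u)
        * Real.exp (-∑ k, cumRate a v j (i.succAbove k) l u) := by
      rw [survival, Fin.sum_univ_succAbove _ i, neg_add, Real.exp_add]
    rw [hsurv, ← mul_assoc (rate a j i _), ENNReal.ofReal_mul (p := rate a j i _ * _)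
      (mul_nonneg (ha.rate_nonneg _ _ _) (Real.exp_pos _).le)]
    ring

theorem JumpRates.measure_lt_hold (ha : JumpRates a) (j : Fin N) (l : Vec d) {s : ℝ}
    (hs : 0 ≤ s) :
    thresholdLaw N {ξ | ENNReal.ofReal s < hold a v j l ξ}
      = ENNReal.ofReal (survival a v j l s) := by
  have h : {ξ | ENNReal.ofReal s < hold a v j l ξ} =ᵐ[thresholdLaw N]
      Set.pi univ fun k => Ioi (cumRate a v j k l s) := by
    filter_upwards [ae_thresholdLaw_pos] with ξ hξ
    apply propext
    change ENNReal.ofReal s < hold a v j l ξ ↔ ξ ∈ Set.pi univ _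
    simp only [Set.mem_pi, mem_univ, true_imp_iff, mem_Ioi]
    constructor
    · intro h k
      exact (ha.lt_clock_iff j k l (hξ k) hs).1 (h.trans_le (hold_le_clock j l ξ k))
    · intro h
      rw [← clock_target]
      exact (ha.lt_clock_iff j _ l (hξ _) hs).2 (h _)
  rw [measure_congr h, Measure.pi_pi, survival, ← Finset.sum_neg_distrib, Real.exp_sum,
    ENNReal.ofReal_prod_of_nonneg fun k _ => (Real.exp_pos _).le]
  exact Finset.prod_congr rfl fun k _ => expMeasure_Ioi (ha.cumRate_nonneg _ _ _ hs)

theorem JumpRates.measurable_hold (ha : JumpRates a) :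
    Measurable fun q : Fin N × Vec d × (Fin N → ℝ) => hold a v q.1 q.2.1 q.2.2 := by
  unfold hold
  refine Measurable.iInf fun i => ?_
  exact (ha.measurable_clock i).comp
    (f := fun q : Fin N × Vec d × (Fin N → ℝ) => (q.1, q.2.1, q.2.2 i)) (by fun_prop)

/-- The choice depends only on the set of indices attaining the minimum. It is thus a function on a
finite discrete space composed with a measurable map. -/
theorem JumpRates.measurable_target (ha : JumpRates a) :
    Measurable fun q : Fin N × Vec d × (Fin N → ℝ) => target a v q.1 q.2.1 q.2.2 := by
  classical
  refine measurable_from_prod_countable_right fun j => ?_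
  let sel : (Fin N → Prop) → Fin N := fun P => if h : ∃ i, P i then h.choose else j
  have hsel : (fun q : Vec d × (Fin N → ℝ) => target a v j q.1 q.2) = fun q =>
      sel fun i => clock a v j q.1 i (q.2 i) = hold a v j q.1 q.2 := by
    ext1 q
    simp only [sel, dif_pos (exists_clock_eq_hold a v j q.1 q.2)]
    rfl
  change Measurable fun q : Vec d × (Fin N → ℝ) => target a v j q.1 q.2
  rw [hsel]
  have hsm : Measurable sel := Measurable.of_discrete
  refine hsm.comp (measurable_pi_lambda _ fun i => ?_)
  refine measurableSet_setOfPred.1 (measurableSet_eq_fun ?_ ?_)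
  · exact (ha.measurable_clock i).comp
      (f := fun q : Vec d × (Fin N → ℝ) => (j, q.1, q.2 i)) (by fun_prop)
  · exact ha.measurable_hold.comp
      (f := fun q : Vec d × (Fin N → ℝ) => (j, q.1, q.2)) (by fun_prop)

/-! ### Markov property of the jump chain -/

/-- A jump time together with the state and the position at that time. -/
abbrev Stage (N d : ℕ) : Type := ℝ≥0∞ × Fin N × Vec d

theorem measurable_velocity : Measurable v := Measurable.of_discrete

theorem JumpRates.measurable_jumpChain (ha : JumpRates a) (n : ℕ) :
    Measurable fun q : (Fin N × Vec d) × Noise N => jumpChain a v q.1 q.2 n := by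
  induction n with
  | zero =>
    simp only [jumpChain]
    fun_prop
  | succ n ih =>
    simp only [jumpChain]
    have hq : Measurable fun q : (Fin N × Vec d) × Noise N =>
        ((jumpChain a v q.1 q.2 n).2.1, (jumpChain a v q.1 q.2 n).2.2, q.2 n) := by fun_prop
    have hh := (ha.measurable_hold (v := v)).comp hq
    have ht := (ha.measurable_target (v := v)).comp hq
    refine (ih.fst.add hh).prodMk (ht.prodMk ?_)
    exact ih.snd.snd.add (hh.ennreal_toReal.smul (measurable_velocity.comp ih.snd.fst))

theorem JumpRates.measurable_jumpChain_noise (ha : JumpRates a) (x : Fin N × Vec d) (n : ℕ) :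
    Measurable fun ω : Noise N => jumpChain a v x ω n :=
  (ha.measurable_jumpChain n).comp measurable_prodMk_left

theorem jumpChain_congr (x : Fin N × Vec d) {n : ℕ} {ω ω' : Noise N}
    (h : ∀ k < n, ω k = ω' k) : jumpChain a v x ω n = jumpChain a v x ω' n := by
  induction n with
  | zero => rfl
  | succ n ih =>
    simp only [jumpChain]
    rw [ih fun k hk => h k (hk.trans n.lt_succ_self), h n n.lt_succ_self]

instance : IsProbabilityMeasure (noiseLaw N) := by
  unfold noiseLaw; infer_instance

/-- Stage n uses only the noise entries before n. Extending these by zero, via `e`, exhibits the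
chain as a function of a finite block that is independent of entry n. -/
theorem JumpRates.indepFun_jumpChain (ha : JumpRates a) (x : Fin N × Vec d) (n : ℕ) :
    IndepFun (fun ω : Noise N => jumpChain a v x ω n) (fun ω => ω n) (noiseLaw N) := by
  classical
  have hind : iIndepFun (fun (i : ℕ) (ω : Noise N) => ω i) (noiseLaw N) :=
    iIndepFun_infinitePi (P := fun _ : ℕ => thresholdLaw N) (X := fun _ ξ => ξ)
      (fun _ => measurable_id)
  have hfin := hind.indepFun_finset (Finset.range n) {n} (by simp) (fun i => measurable_pi_apply i)
  let e : (Finset.range n → Fin N → ℝ) → Noise N :=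
    fun y k => if h : k ∈ Finset.range n then y ⟨k, h⟩ else 0
  have he : Measurable e := by
    refine measurable_pi_lambda _ fun k => ?_
    by_cases h : k ∈ Finset.range n
    · simp only [e, dif_pos h]; fun_prop
    · simp only [e, dif_neg h]; fun_prop
  have hev : Measurable fun y : ({n} : Finset ℕ) → Fin N → ℝ =>
      y ⟨n, Finset.mem_singleton_self n⟩ := measurable_pi_apply _
  have hcomp := hfin.comp (φ := fun y => jumpChain a v x (e y) n)
    (ψ := fun y => y ⟨n, Finset.mem_singleton_self n⟩)
    ((ha.measurable_jumpChain_noise x n).comp he) hev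
  have heq : (fun ω : Noise N => jumpChain a v x ω n) =
      (fun y => jumpChain a v x (e y) n) ∘ fun ω (i : Finset.range n) => ω i := by
    ext1 ω
    refine jumpChain_congr x fun k hk => ?_
    simp [e, hk]
  rw [heq]
  exact hcomp

theorem JumpRates.lintegral_jumpChain_noise (ha : JumpRates a) (x : Fin N × Vec d) (n : ℕ)
    {F : Stage N d × (Fin N → ℝ) → ℝ≥0∞} (hF : Measurable F) :
    ∫⁻ ω, F (jumpChain a v x ω n, ω n) ∂noiseLaw N
      = ∫⁻ ω, ∫⁻ ξ, F (jumpChain a v x ω n, ξ) ∂thresholdLaw N ∂noiseLaw N := by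
  have hc := ha.measurable_jumpChain_noise (v := v) x n
  have hmap := (ha.indepFun_jumpChain (v := v) x n).map_prod_eq_prod_map_map hc.aemeasurable
    (measurable_pi_apply n).aemeasurable
  have hev : (noiseLaw N).map (fun ω => ω n) = thresholdLaw N :=
    Measure.infinitePi_map_eval _ n
  rw [hev] at hmap
  rw [← lintegral_map (f := F) (g := fun ω : Noise N => (jumpChain a v x ω n, ω n)) hF
    (by fun_prop), hmap, lintegral_prod _ hF.aemeasurable,
    lintegral_map hF.lintegral_prod_right' hc]

/-- The transition operator of the chain of jumps. -/
def stepOp (a : Fin N → Fin N → Vec d → ℝ) (v : Fin N → Vec d) (Φ : Stage N d → ℝ≥0∞)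
    (z : Stage N d) : ℝ≥0∞ :=
  ∑ i, ∫⁻ u in Ioi 0,
    ENNReal.ofReal (rate a z.2.1 i (z.2.2 + u • v z.2.1) * survival a v z.2.1 z.2.2 u)
      * Φ (z.1 + ENNReal.ofReal u, i, z.2.2 + u • v z.2.1)

/-- `stepOp` integrates over finite holding times only; the vanishing of Φ at time ∞ accounts for
the event of no further jump. -/
theorem JumpRates.lintegral_jumpChain_succ (ha : JumpRates a) (x : Fin N × Vec d) (n : ℕ)
    {Φ : Stage N d → ℝ≥0∞} (hΦ : Measurable Φ) (hΦ_top : ∀ y, Φ (∞, y) = 0) :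
    ∫⁻ ω, Φ (jumpChain a v x ω (n + 1)) ∂noiseLaw N
      = ∫⁻ ω, stepOp a v Φ (jumpChain a v x ω n) ∂noiseLaw N := by
  let F : Stage N d × (Fin N → ℝ) → ℝ≥0∞ := fun q =>
    Φ (q.1.1 + hold a v q.1.2.1 q.1.2.2 q.2, target a v q.1.2.1 q.1.2.2 q.2,
      q.1.2.2 + (hold a v q.1.2.1 q.1.2.2 q.2).toReal • v q.1.2.1)
  have hq : Measurable fun q : Stage N d × (Fin N → ℝ) => (q.1.2.1, q.1.2.2, q.2) := by fun_prop
  have hh := (ha.measurable_hold (v := v)).comp hq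
  have ht := (ha.measurable_target (v := v)).comp hq
  have hF : Measurable F := by
    refine hΦ.comp ((measurable_fst.fst.add hh).prodMk (ht.prodMk ?_))
    exact measurable_fst.snd.snd.add
      (hh.ennreal_toReal.smul (measurable_velocity.comp measurable_fst.snd.fst))
  have h := ha.lintegral_jumpChain_noise (v := v) x n hF
  change ∫⁻ ω, F (jumpChain a v x ω n, ω n) ∂noiseLaw N = _
  rw [h]
  refine lintegral_congr fun ω => ?_
  set z := jumpChain a v x ω n
  rw [stepOp, ← ha.lintegral_hold_target z.2.1 z.2.2
    (φ := fun u i => Φ (z.1 + ENNReal.ofReal u, i, z.2.2 + u • v z.2.1))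
    fun i => hΦ.comp (by fun_prop)]
  refine lintegral_congr fun ξ => ?_
  by_cases hfin : hold a v z.2.1 z.2.2 ξ = ∞
  · simp [F, hfin, hΦ_top]
  · simp [F, hfin, ENNReal.ofReal_toReal]

/-! ### Decomposition at the last jump -/

/-- The transition operator of the process killed at its first jump. -/
def killedOp (a : Fin N → Fin N → Vec d → ℝ) (v : Fin N → Vec d) (t : ℝ)
    (f : Fin N × Vec d → ℝ≥0∞) (x : Fin N × Vec d) : ℝ≥0∞ :=
  ENNReal.ofReal (survival a v x.1 x.2 t) * f (x.1, x.2 + t • v x.1)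

/-- The jump part of the generator. -/
def jumpOp (a : Fin N → Fin N → Vec d → ℝ) (f : Fin N × Vec d → ℝ≥0∞) (x : Fin N × Vec d) :
    ℝ≥0∞ :=
  ∑ i, ENNReal.ofReal (rate a x.1 i x.2) * f (i, x.2)

/-- The conditional expectation of `f (X t, L t)` on there being no further jump up to
time `t`, given the current stage. -/
def stageOp (a : Fin N → Fin N → Vec d → ℝ) (v : Fin N → Vec d) (t : ℝ)
    (f : Fin N × Vec d → ℝ≥0∞) (z : Stage N d) : ℝ≥0∞ :=
  if z.1 ≤ ENNReal.ofReal t then killedOp a v (t - z.1.toReal) f z.2 else 0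

theorem JumpRates.measurable_survival (ha : JumpRates a) :
    Measurable fun q : Fin N × Vec d × ℝ => survival a v q.1 q.2.1 q.2.2 :=
  measurable_from_prod_countable_right fun j => (ha.continuous_survival j).measurable

theorem JumpRates.measurable_rate (ha : JumpRates a) (i : Fin N) :
    Measurable fun q : Fin N × Vec d => rate a q.1 i q.2 :=
  measurable_from_prod_countable_right fun j => (ha.continuous_rate j i).measurable

theorem JumpRates.measurable_killedOp (ha : JumpRates a) {α : Type*} [MeasurableSpace α]
    {f : α → Fin N × Vec d → ℝ≥0∞} (hf : Measurable (Function.uncurry f)) {s : α → ℝ}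
    (hs : Measurable s) {x : α → Fin N × Vec d} (hx : Measurable x) :
    Measurable fun q => killedOp a v (s q) (f q) (x q) := by
  unfold killedOp
  refine Measurable.mul ?_ ?_
  · exact (ha.measurable_survival.comp
      (hx.fst.prodMk (hx.snd.prodMk hs))).ennreal_ofReal
  · exact hf.comp (measurable_id.prodMk (hx.fst.prodMk
      (hx.snd.add (hs.smul (measurable_velocity.comp hx.fst)))))

theorem JumpRates.measurable_jumpOp (ha : JumpRates a) {α : Type*} [MeasurableSpace α]
    {f : α → Fin N × Vec d → ℝ≥0∞} (hf : Measurable (Function.uncurry f))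
    {x : α → Fin N × Vec d} (hx : Measurable x) :
    Measurable fun q => jumpOp a (f q) (x q) := by
  unfold jumpOp
  refine Finset.measurable_sum _ fun i _ => Measurable.mul ?_ ?_
  · exact ((ha.measurable_rate i).comp hx).ennreal_ofReal
  · exact hf.comp (measurable_id.prodMk (measurable_const.prodMk hx.snd))

theorem JumpRates.measurable_stageOp (ha : JumpRates a) {α : Type*} [MeasurableSpace α]
    {f : α → Fin N × Vec d → ℝ≥0∞} (hf : Measurable (Function.uncurry f)) {s : α → ℝ}
    (hs : Measurable s) {z : α → Stage N d} (hz : Measurable z) :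
    Measurable fun q => stageOp a v (s q) (f q) (z q) := by
  unfold stageOp
  refine Measurable.ite (measurableSet_le hz.fst hs.ennreal_ofReal) ?_ measurable_const
  exact ha.measurable_killedOp hf (hs.sub hz.fst.ennreal_toReal) hz.snd

theorem JumpRates.measurable_jumpOp_killedOp (ha : JumpRates a)
    {f : Fin N × Vec d → ℝ≥0∞} (hf : Measurable f) {α : Type*} [MeasurableSpace α]
    {s : α → ℝ} (hs : Measurable s) :
    Measurable (Function.uncurry fun q => jumpOp a (killedOp a v (s q) f)) := by
  have h1 : Measurable (Function.uncurry fun (q : α × (Fin N × Vec d)) =>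
      killedOp a v (s q.1) f) :=
    ha.measurable_killedOp (f := fun _ => f) (hf.comp measurable_snd)
      (hs.comp measurable_fst.fst) measurable_snd
  exact ha.measurable_jumpOp h1 measurable_snd

/-- Both sides describe exactly one more jump up to t. Substituting r = s + u, with s the current
jump time, passes from the holding time u to the jump time r. -/
theorem JumpRates.stepOp_stageOp (ha : JumpRates a) {f : Fin N × Vec d → ℝ≥0∞}
    (hf : Measurable f) {t : ℝ} (ht : 0 ≤ t) (z : Stage N d) :
    stepOp a v (stageOp a v t f) z
      = ∫⁻ r in Ioc 0 t, stageOp a v r (jumpOp a (killedOp a v (t - r) f)) z := by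
  obtain ⟨τ, j, l⟩ := z
  by_cases hτ : τ ≤ ENNReal.ofReal t
  swap
  · have h1 : ∀ u i l', stageOp a v t f (τ + ENNReal.ofReal u, i, l') = 0 := fun u i l' =>
      if_neg fun h => hτ (le_self_add.trans h)
    have h2 : ∀ r ∈ Ioc 0 t, stageOp a v r (jumpOp a (killedOp a v (t - r) f)) (τ, j, l) = 0 :=
      fun r hr => if_neg fun h => hτ (h.trans (ENNReal.ofReal_le_ofReal hr.2))
    rw [setLIntegral_congr_fun measurableSet_Ioc h2]
    simp [stepOp, h1]
  obtain ⟨s, hs0, rfl⟩ : ∃ s, 0 ≤ s ∧ τ = ENNReal.ofReal s :=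
    ⟨τ.toReal, ENNReal.toReal_nonneg,
      (ENNReal.ofReal_toReal (hτ.trans_lt ENNReal.ofReal_lt_top).ne).symm⟩
  have hst : s ≤ t := (ENNReal.ofReal_le_ofReal_iff ht).1 hτ
  let K : ℝ → ℝ≥0∞ := fun r =>
    killedOp a v (r - s) (jumpOp a (killedOp a v (t - r) f)) (j, l)
  have hright : ∫⁻ r in Ioc 0 t,
      stageOp a v r (jumpOp a (killedOp a v (t - r) f)) (ENNReal.ofReal s, j, l)
      = ∫⁻ r, (Ioc s t).indicator K r := by
    rw [← lintegral_indicator measurableSet_Ioc]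
    refine lintegral_congr_ae ?_
    have hne : ∀ᵐ r : ℝ, r ≠ s := by simp [ae_iff]
    filter_upwards [hne] with r hr
    by_cases h1 : r ∈ Ioc 0 t
    · by_cases h2 : s ≤ r
      · have h3 : r ∈ Ioc s t := ⟨lt_of_le_of_ne h2 hr.symm, h1.2⟩
        rw [indicator_of_mem h1, indicator_of_mem h3, stageOp,
          if_pos (ENNReal.ofReal_le_ofReal h2), ENNReal.toReal_ofReal hs0]
      · have h3 : r ∉ Ioc s t := fun h => h2 h.1.le
        rw [indicator_of_mem h1, indicator_of_notMem h3, stageOp, if_neg]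
        exact fun h => h2 ((ENNReal.ofReal_le_ofReal_iff h1.1.le).1 h)
    · have h3 : r ∉ Ioc s t := fun h => h1 ⟨hs0.trans_lt h.1, h.2⟩
      rw [indicator_of_notMem h1, indicator_of_notMem h3]
  rw [hright, ← lintegral_add_left_eq_self _ s, stepOp, ← lintegral_finsetSum]
  · rw [← lintegral_indicator measurableSet_Ioi]
    refine lintegral_congr fun u => ?_
    by_cases hu : 0 < u
    swap
    · have h3 : s + u ∉ Ioc s t := fun h => hu (by linarith [h.1])
      rw [indicator_of_notMem (by simpa using hu), indicator_of_notMem h3]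
    rw [indicator_of_mem (mem_Ioi.2 hu)]
    simp only [stageOp, ← ENNReal.ofReal_add hs0 hu.le]
    by_cases hsu : s + u ≤ t
    · have h3 : s + u ∈ Ioc s t := ⟨by linarith, hsu⟩
      rw [indicator_of_mem h3]
      simp only [if_pos (ENNReal.ofReal_le_ofReal hsu),
        ENNReal.toReal_ofReal (add_nonneg hs0 hu.le)]
      simp only [K, killedOp, jumpOp, add_sub_cancel_left, Finset.mul_sum]
      refine Finset.sum_congr rfl fun i _ => ?_
      rw [ENNReal.ofReal_mul (ha.rate_nonneg _ _ _)]
      ring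
    · have h3 : s + u ∉ Ioc s t := fun h => hsu h.2
      have h4 : ¬ENNReal.ofReal (s + u) ≤ ENNReal.ofReal t :=
        fun h => hsu ((ENNReal.ofReal_le_ofReal_iff ht).1 h)
      rw [indicator_of_notMem h3]
      simp [h4]
  · intro i _
    refine Measurable.mul ?_ ?_
    · refine Measurable.ennreal_ofReal (Continuous.measurable ?_)
      exact (ha.continuous_rate_line j i l).mul
        ((ha.continuous_survival j).comp (Continuous.prodMk_right l))
    · exact ha.measurable_stageOp (f := fun _ => f) (hf.comp measurable_snd) measurable_const
        (by fun_prop)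

/-- The expectation of `f (X t, L t)` on the event that there are exactly `n` jumps in `[0, t]`. -/
def jumpSemigroup (a : Fin N → Fin N → Vec d → ℝ) (v : Fin N → Vec d) (n : ℕ) (t : ℝ)
    (f : Fin N × Vec d → ℝ≥0∞) (x : Fin N × Vec d) : ℝ≥0∞ :=
  ∫⁻ ω, stageOp a v t f (jumpChain a v x ω n) ∂noiseLaw N

theorem jumpSemigroup_zero {t : ℝ} (f : Fin N × Vec d → ℝ≥0∞) (x : Fin N × Vec d) :
    jumpSemigroup a v 0 t f x = killedOp a v t f x := by
  simp [jumpSemigroup, jumpChain, stageOp]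

theorem JumpRates.jumpSemigroup_succ (ha : JumpRates a) (n : ℕ) {t : ℝ} (ht : 0 ≤ t)
    {f : Fin N × Vec d → ℝ≥0∞} (hf : Measurable f) (x : Fin N × Vec d) :
    jumpSemigroup a v (n + 1) t f x
      = ∫⁻ r in Ioc 0 t, jumpSemigroup a v n r (jumpOp a (killedOp a v (t - r) f)) x := by
  unfold jumpSemigroup
  rw [ha.lintegral_jumpChain_succ x n]
  · simp_rw [ha.stepOp_stageOp hf ht]
    rw [lintegral_lintegral_swap]
    refine Measurable.aemeasurable ?_
    refine ha.measurable_stageOp (α := Noise N × ℝ)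
      (f := fun q => jumpOp a (killedOp a v (t - q.2) f)) ?_ measurable_snd
      ((ha.measurable_jumpChain_noise x n).comp measurable_fst)
    exact ha.measurable_jumpOp_killedOp hf (measurable_const.sub measurable_snd)
  · exact ha.measurable_stageOp (f := fun _ => f) (hf.comp measurable_snd) measurable_const
      measurable_id
  · intro y
    simp [stageOp]

theorem JumpRates.measurable_jumpSemigroup (ha : JumpRates a) (n : ℕ)
    {α : Type*} [MeasurableSpace α]
    {f : α → Fin N × Vec d → ℝ≥0∞} (hf : Measurable (Function.uncurry f)) {s : α → ℝ}
    (hs : Measurable s) {x : α → Fin N × Vec d} (hx : Measurable x) :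
    Measurable fun q => jumpSemigroup a v n (s q) (f q) (x q) := by
  unfold jumpSemigroup
  refine Measurable.lintegral_prod_right' (f := fun q : α × Noise N =>
    stageOp a v (s q.1) (f q.1) (jumpChain a v (x q.1) q.2 n)) ?_
  refine ha.measurable_stageOp (f := fun q : α × Noise N => f q.1) ?_ (hs.comp measurable_fst)
    ((ha.measurable_jumpChain n).comp ((hx.comp measurable_fst).prodMk measurable_snd))
  exact hf.comp (measurable_fst.fst.prodMk measurable_snd)

/-- The position at time `t` if `z` is the last stage reached up to time `t`. -/
def stagePosition (v : Fin N → Vec d) (t : ℝ) (z : Stage N d) : Fin N × Vec d :=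
  (z.2.1, z.2.2 + (t - z.1.toReal) • v z.2.1)

theorem measurable_stagePosition (t : ℝ) : Measurable (stagePosition v t) := by
  unfold stagePosition
  refine measurable_snd.fst.prodMk (measurable_snd.snd.add ?_)
  exact (measurable_const.sub measurable_fst.ennreal_toReal).smul
    (measurable_velocity.comp measurable_snd.fst)

/-- The event that there are exactly `n` jumps in `[0, t]`. -/
def jumpEvent (a : Fin N → Fin N → Vec d → ℝ) (v : Fin N → Vec d) (t : ℝ) (n : ℕ) :
    Set ((Fin N × Vec d) × Noise N) :=
  {q | (jumpChain a v q.1 q.2 n).1 ≤ ENNReal.ofReal t ∧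
    ENNReal.ofReal t < (jumpChain a v q.1 q.2 (n + 1)).1}

theorem JumpRates.measurableSet_jumpEvent (ha : JumpRates a) (t : ℝ) (n : ℕ) :
    MeasurableSet (jumpEvent a v t n) :=
  (measurableSet_le (ha.measurable_jumpChain n).fst measurable_const).inter
    (measurableSet_lt measurable_const (ha.measurable_jumpChain (n + 1)).fst)

/-- Given stage n at time τ ≤ t, the fresh noise entry n makes the next holding time exceed t - τ
with the survival probability, while the position at t is already determined. -/
theorem JumpRates.lintegral_jumpEvent (ha : JumpRates a) (x : Fin N × Vec d) (n : ℕ) {t : ℝ}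
    (ht : 0 ≤ t) {f : Fin N × Vec d → ℝ≥0∞} (hf : Measurable f) :
    ∫⁻ ω, (jumpEvent a v t n).indicator
        (fun q => f (stagePosition v t (jumpChain a v q.1 q.2 n))) (x, ω) ∂noiseLaw N
      = jumpSemigroup a v n t f x := by
  classical
  let F : Stage N d × (Fin N → ℝ) → ℝ≥0∞ := fun q =>
    if q.1.1 ≤ ENNReal.ofReal t ∧ ENNReal.ofReal t < q.1.1 + hold a v q.1.2.1 q.1.2.2 q.2
      then f (stagePosition v t q.1) else 0
  have hh : Measurable fun q : Stage N d × (Fin N → ℝ) => hold a v q.1.2.1 q.1.2.2 q.2 :=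
    (ha.measurable_hold (v := v)).comp
      (f := fun q : Stage N d × (Fin N → ℝ) => (q.1.2.1, q.1.2.2, q.2)) (by fun_prop)
  have hF : Measurable F := by
    refine Measurable.ite ?_ (hf.comp ((measurable_stagePosition t).comp measurable_fst))
      measurable_const
    exact (measurableSet_le measurable_fst.fst measurable_const).inter
      (measurableSet_lt measurable_const (measurable_fst.fst.add hh))
  have h := ha.lintegral_jumpChain_noise (v := v) x n hF
  have hleft : ∀ ω, (jumpEvent a v t n).indicator
      (fun q => f (stagePosition v t (jumpChain a v q.1 q.2 n))) (x, ω)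
      = F (jumpChain a v x ω n, ω n) := by
    intro ω
    rw [indicator_apply]
    exact if_congr Iff.rfl rfl rfl
  rw [lintegral_congr hleft, h, jumpSemigroup]
  refine lintegral_congr fun ω => ?_
  obtain ⟨τ, j, l⟩ := jumpChain a v x ω n
  by_cases hτ : τ ≤ ENNReal.ofReal t
  swap
  · simp [F, stageOp, hτ]
  have hτ' : τ ≠ ∞ := (hτ.trans_lt ENNReal.ofReal_lt_top).ne
  have hτt : τ.toReal ≤ t := (ENNReal.le_ofReal_iff_toReal_le hτ' ht).1 hτ
  have hset : MeasurableSet {ξ | ENNReal.ofReal (t - τ.toReal) < hold a v j l ξ} :=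
    measurableSet_lt measurable_const (ha.measurable_hold.comp
      (f := fun ξ : Fin N → ℝ => (j, l, ξ)) (by fun_prop))
  have hin : ∀ ξ, F ((τ, j, l), ξ) =
      {ξ | ENNReal.ofReal (t - τ.toReal) < hold a v j l ξ}.indicator
        (fun _ => f (stagePosition v t (τ, j, l))) ξ := by
    intro ξ
    have hiff : ENNReal.ofReal t < τ + hold a v j l ξ ↔
        ENNReal.ofReal (t - τ.toReal) < hold a v j l ξ := by
      rw [ENNReal.ofReal_sub _ ENNReal.toReal_nonneg, ENNReal.ofReal_toReal hτ',
        ENNReal.sub_lt_iff_lt_left hτ' hτ]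
    simp only [F, hτ, hiff, true_and, indicator]
    rfl
  rw [lintegral_congr hin, lintegral_indicator_const hset,
    ha.measure_lt_hold j l (sub_nonneg.2 hτt), stageOp, if_pos hτ, killedOp, mul_comm]
  rfl

/-! ### Non-explosion -/

theorem jumpChain_time_mono (x : Fin N × Vec d) (ω : Noise N) :
    Monotone fun n => (jumpChain a v x ω n).1 :=
  monotone_nat_of_le_succ fun n => by
    simp only [jumpChain]
    exact le_self_add

theorem jumpChain_dist_le {M : ℝ} (hM : ∀ j, ‖v j‖ ≤ M) (x : Fin N × Vec d) (ω : Noise N) (n : ℕ)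
    (hn : (jumpChain a v x ω n).1 ≠ ∞) :
    ‖(jumpChain a v x ω n).2.2 - x.2‖ ≤ M * (jumpChain a v x ω n).1.toReal := by
  induction n with
  | zero => simp [jumpChain]
  | succ n ih =>
    simp only [jumpChain] at hn ⊢
    set z := jumpChain a v x ω n
    set τ := hold a v z.2.1 z.2.2 (ω n)
    have hz : z.1 ≠ ∞ := fun h => hn (by simp [h])
    have hτ : τ ≠ ∞ := fun h => hn (by simp [h])
    rw [ENNReal.toReal_add hz hτ, add_sub_right_comm, mul_add]
    refine (norm_add_le _ _).trans (add_le_add (ih hz) ?_)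
    rw [norm_smul, Real.norm_of_nonneg ENNReal.toReal_nonneg, mul_comm]
    exact mul_le_mul_of_nonneg_right (hM _) ENNReal.toReal_nonneg

theorem JumpRates.exists_exitRate_bound (ha : JumpRates a) (l : Vec d) (R : ℝ) :
    ∃ K : ℝ, 0 < K ∧ ∀ j, ∀ l' : Vec d, ‖l' - l‖ ≤ R → ∑ i, rate a j i l' ≤ K := by
  have h : ∀ j, ∃ C : ℝ, ∀ l' ∈ Metric.closedBall l R, ‖∑ i, rate a j i l'‖ ≤ C := fun j =>
    (isCompact_closedBall l R).exists_bound_of_continuousOn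
      (continuous_finsetSum _ fun i _ => ha.continuous_rate j i).continuousOn
  choose C hC using h
  refine ⟨1 + ∑ j, |C j|, by positivity, fun j l' hl' => ?_⟩
  have h1 := hC j l' (mem_closedBall_iff_norm.2 hl')
  have h2 : |C j| ≤ ∑ j, |C j| :=
    Finset.single_le_sum (f := fun j => |C j|) (fun j _ => abs_nonneg _) (Finset.mem_univ j)
  linarith [le_abs_self (C j), Real.le_norm_self (∑ i, rate a j i l')]

/-- With jump rate at most K, the discount 2K makes each jump cost a factor 1/2. -/
theorem lintegral_exp_neg_le_half {K : ℝ} (hK : 0 < K) :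
    ∫⁻ u in Ioi 0, ENNReal.ofReal (K * Real.exp (-(2 * K * u))) ≤ 2⁻¹ := by
  have h1 : ∫⁻ u in Ioi 0, ENNReal.ofReal (K * Real.exp (-(2 * K * u)))
      = ∫⁻ u in Ioi 0, 2⁻¹ * exponentialPDF (2 * K) u := by
    refine setLIntegral_congr_fun measurableSet_Ioi fun u hu => ?_
    rw [exponentialPDF_of_nonneg (le_of_lt hu), mul_assoc 2 K (Real.exp _),
      ENNReal.ofReal_mul (p := 2) zero_le_two, ENNReal.ofReal_ofNat, ← mul_assoc,
      ENNReal.inv_mul_cancel two_ne_zero ENNReal.ofNat_ne_top, one_mul]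
  rw [h1, lintegral_const_mul _ (by unfold exponentialPDF; fun_prop)]
  calc 2⁻¹ * ∫⁻ u in Ioi 0, exponentialPDF (2 * K) u
      ≤ 2⁻¹ * ∫⁻ u, exponentialPDF (2 * K) u := by
        gcongr; exact Measure.restrict_le_self
    _ = 2⁻¹ := by rw [lintegral_exponentialPDF_eq_one (by positivity), mul_one]

/-- The process does not explode. -/
theorem JumpRates.ae_exists_lt_jumpChain (ha : JumpRates a) (x : Fin N × Vec d) {t : ℝ}
    (ht : 0 ≤ t) :
    ∀ᵐ ω ∂noiseLaw N, ∃ n, ENNReal.ofReal t < (jumpChain a v x ω n).1 := by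
  classical
  set M : ℝ := ∑ j, ‖v j‖
  have hM : ∀ j, ‖v j‖ ≤ M := fun j =>
    Finset.single_le_sum (f := fun j => ‖v j‖) (fun j _ => norm_nonneg _) (Finset.mem_univ j)
  have hM0 : 0 ≤ M := Finset.sum_nonneg fun j _ => norm_nonneg _
  -- Up to time t the position stays within M * t of its start, so K bounds all exit rates that
  -- matter.
  obtain ⟨K, hK, hbd⟩ := ha.exists_exitRate_bound x.2 (M * t)
  set good : Set (Stage N d) :=
    {z | z.1 ≤ ENNReal.ofReal t ∧ ‖z.2.2 - x.2‖ ≤ M * z.1.toReal} with hgood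
  have hgm : MeasurableSet good :=
    (measurableSet_le measurable_fst measurable_const).inter
      (measurableSet_le (by fun_prop) (measurable_const.mul measurable_fst.ennreal_toReal))
  -- The discounted indicator exp(-2K T_n) on T_n ≤ t; its expectation at stage n is at most 2^(-n).
  set Φ : Stage N d → ℝ≥0∞ :=
    good.indicator fun z => ENNReal.ofReal (Real.exp (-(2 * K * z.1.toReal))) with hΦ
  have hΦm : Measurable Φ := by
    refine Measurable.indicator ?_ hgm
    exact (Real.measurable_exp.comp
      (measurable_const.mul measurable_fst.ennreal_toReal).neg).ennreal_ofReal
  have hΦ_top : ∀ y, Φ (∞, y) = 0 := fun y => by simp [hΦ, hgood]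
  have hsupp : ∀ ω n, (jumpChain a v x ω n).1 ≤ ENNReal.ofReal t →
      jumpChain a v x ω n ∈ good := fun ω n h =>
    ⟨h, jumpChain_dist_le hM x ω n (h.trans_lt ENNReal.ofReal_lt_top).ne⟩
  have hstep : ∀ ω n, stepOp a v Φ (jumpChain a v x ω n) ≤ 2⁻¹ * Φ (jumpChain a v x ω n) := by
    intro ω n
    set z := jumpChain a v x ω n with hz
    by_cases hzt : z.1 ≤ ENNReal.ofReal t
    swap
    · have h0 : ∀ u i l', Φ (z.1 + u, i, l') = 0 := fun u i l' =>
        indicator_of_notMem (fun h => hzt (le_self_add.trans h.1)) _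
      simp [stepOp, h0]
    have hzg : z ∈ good := hsupp ω n hzt
    have hz_top : z.1 ≠ ∞ := (hzt.trans_lt ENNReal.ofReal_lt_top).ne
    have hpt : ∀ u ∈ Ioi (0 : ℝ), ∑ i,
        ENNReal.ofReal (rate a z.2.1 i (z.2.2 + u • v z.2.1) * survival a v z.2.1 z.2.2 u)
          * Φ (z.1 + ENNReal.ofReal u, i, z.2.2 + u • v z.2.1)
        ≤ ENNReal.ofReal (K * Real.exp (-(2 * K * u))) * Φ z := by
      intro u hu
      have hu0 : 0 ≤ u := le_of_lt hu
      by_cases hg : z.1 + ENNReal.ofReal u ≤ ENNReal.ofReal t ∧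
          ‖z.2.2 + u • v z.2.1 - x.2‖ ≤ M * (z.1 + ENNReal.ofReal u).toReal
      swap
      · have h0 : ∀ i, Φ (z.1 + ENNReal.ofReal u, i, z.2.2 + u • v z.2.1) = 0 := fun i =>
          indicator_of_notMem (show _ ∉ good from hg) _
        simp [h0]
      have h1 : ∀ i, Φ (z.1 + ENNReal.ofReal u, i, z.2.2 + u • v z.2.1)
          = ENNReal.ofReal (Real.exp (-(2 * K * u))) * Φ z := by
        intro i
        rw [hΦ, indicator_of_mem hzg, indicator_of_mem (show _ ∈ good from hg),
          ← ENNReal.ofReal_mul (Real.exp_pos _).le, ← Real.exp_add,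
          ENNReal.toReal_add hz_top ENNReal.ofReal_ne_top, ENNReal.toReal_ofReal hu0]
        congr 2; ring
      simp_rw [h1]
      rw [← Finset.sum_mul, ENNReal.ofReal_mul hK.le, mul_assoc (ENNReal.ofReal K),
        ← ENNReal.ofReal_sum_of_nonneg fun i _ =>
          mul_nonneg (ha.rate_nonneg _ _ _) (survival_pos _ _ _).le]
      refine mul_le_mul_left (ENNReal.ofReal_le_ofReal ?_) _
      rw [← Finset.sum_mul]
      have hle : ∑ i, rate a z.2.1 i (z.2.2 + u • v z.2.1) ≤ K := by
        refine hbd _ _ (hg.2.trans (mul_le_mul_of_nonneg_left ?_ hM0))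
        exact ENNReal.toReal_le_of_le_ofReal ht hg.1
      calc (∑ i, rate a z.2.1 i (z.2.2 + u • v z.2.1)) * survival a v z.2.1 z.2.2 u
          ≤ K * 1 := mul_le_mul hle (ha.survival_le_one _ _ hu0) (survival_pos _ _ _).le hK.le
        _ = K := mul_one K
    rw [stepOp, ← lintegral_finsetSum]
    · calc _ ≤ ∫⁻ u in Ioi 0, ENNReal.ofReal (K * Real.exp (-(2 * K * u))) * Φ z :=
            setLIntegral_mono (by fun_prop) hpt
        _ = (∫⁻ u in Ioi 0, ENNReal.ofReal (K * Real.exp (-(2 * K * u)))) * Φ z :=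
            lintegral_mul_const _ (by fun_prop)
        _ ≤ 2⁻¹ * Φ z := by gcongr; exact lintegral_exp_neg_le_half hK
    · intro i _
      refine Measurable.mul ?_ (hΦm.comp (by fun_prop))
      refine Measurable.ennreal_ofReal (Continuous.measurable ?_)
      exact (ha.continuous_rate_line _ i _).mul
        ((ha.continuous_survival _).comp (Continuous.prodMk_right _))
  have hw : ∀ n, ∫⁻ ω, Φ (jumpChain a v x ω n) ∂noiseLaw N ≤ 2⁻¹ ^ n := by
    intro n
    induction n with
    | zero => simp [jumpChain, hΦ, hgood]
    | succ n ih =>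
      rw [ha.lintegral_jumpChain_succ x n hΦm hΦ_top, pow_succ']
      calc _ ≤ ∫⁻ ω, 2⁻¹ * Φ (jumpChain a v x ω n) ∂noiseLaw N := lintegral_mono fun ω => hstep ω n
        _ = 2⁻¹ * ∫⁻ ω, Φ (jumpChain a v x ω n) ∂noiseLaw N :=
            lintegral_const_mul _ (hΦm.comp (ha.measurable_jumpChain_noise x n))
        _ ≤ _ := by gcongr
  set c : ℝ≥0∞ := ENNReal.ofReal (Real.exp (-(2 * K * t))) with hc
  have hc0 : c ≠ 0 := by simp [hc, Real.exp_pos]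
  -- Markov's inequality: if all jump times are at most t, then Φ is at least c at every stage.
  have hbound : ∀ n, c * noiseLaw N {ω | ¬∃ n, ENNReal.ofReal t < (jumpChain a v x ω n).1}
      ≤ 2⁻¹ ^ n := by
    intro n
    refine le_trans ?_ (hw n)
    refine le_trans ?_ (mul_meas_ge_le_lintegral (hΦm.comp (ha.measurable_jumpChain_noise x n)) c)
    gcongr
    intro h
    push Not at h
    have hg := hsupp _ n (h n)
    simp only [Function.comp, hΦ]
    rw [indicator_of_mem hg]
    refine ENNReal.ofReal_le_ofReal (Real.exp_le_exp.2 (neg_le_neg ?_))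
    exact mul_le_mul_of_nonneg_left (ENNReal.toReal_le_of_le_ofReal ht (h n)) (by positivity)
  rw [ae_iff]
  have hlim : Tendsto (fun n : ℕ => (2⁻¹ : ℝ≥0∞) ^ n) atTop (𝓝 0) :=
    ENNReal.tendsto_pow_atTop_nhds_zero_of_lt_one (by simp)
  have h0 := ge_of_tendsto' hlim hbound
  exact (mul_eq_zero.1 (le_zero_iff.1 h0)).resolve_left hc0

theorem JumpRates.ae_exists_mem_jumpEvent (ha : JumpRates a) {ρ : Measure (Fin N × Vec d)}
    [SFinite ρ] {t : ℝ} (ht : 0 ≤ t) :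
    ∀ᵐ q ∂ρ.prod (noiseLaw N), q ∈ ⋃ n, jumpEvent a v t n := by
  classical
  refine (Measure.ae_prod_iff_ae_ae
    (MeasurableSet.iUnion fun n => ha.measurableSet_jumpEvent t n)).2 (ae_of_all _ fun x => ?_)
  filter_upwards [ha.ae_exists_lt_jumpChain (v := v) x ht] with ω hω
  have h0 : Nat.find hω ≠ 0 := by
    intro h
    have := Nat.find_spec hω
    rw [h] at this
    simp [jumpChain] at this
  obtain ⟨n, hn⟩ := Nat.exists_eq_succ_of_ne_zero h0
  refine mem_iUnion.2 ⟨n, ?_, ?_⟩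
  · exact not_lt.1 (Nat.find_min hω (m := n) (by omega))
  · have := Nat.find_spec hω
    rwa [hn] at this

/-! ### From the jump chain to the process -/

theorem pairwise_disjoint_jumpEvent (t : ℝ) :
    Pairwise (Function.onFun Disjoint (jumpEvent a v t)) := by
  have key : ∀ m n, m < n → Disjoint (jumpEvent a v t m) (jumpEvent a v t n) := by
    intro m n hmn
    refine Set.disjoint_left.2 fun q hm hn => ?_
    exact absurd (hm.2.trans_le ((jumpChain_time_mono q.1 q.2 hmn).trans hn.1)) (lt_irrefl _)
  intro m n hmn
  rcases lt_or_gt_of_ne hmn with h | h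
  · exact key m n h
  · exact (key n m h).symm

theorem jumpCount_eq {x : Fin N × Vec d} {ω : Noise N} {t : ℝ} {n : ℕ}
    (h : (x, ω) ∈ jumpEvent a v t n) : jumpCount a v x t ω = n := by
  have : {m : ℕ | (jumpChain a v x ω m).1 ≤ ENNReal.ofReal t} = Iic n := by
    ext m
    refine ⟨fun hm => ?_, fun hm => (jumpChain_time_mono x ω hm).trans h.1⟩
    by_contra hlt
    exact absurd (h.2.trans_le ((jumpChain_time_mono x ω (Nat.lt_of_not_le hlt)).trans hm)) (lt_irrefl _)
  rw [jumpCount, this, csSup_Iic]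

theorem X_eq {x : Fin N × Vec d} {ω : Noise N} {t : ℝ} {n : ℕ}
    (h : (x, ω) ∈ jumpEvent a v t n) : X a v x t ω = (jumpChain a v x ω n).2.1 := by
  rw [X, jumpCount_eq h]

/-- The Lebesgue measure of a level set of a function that is constant on `[b, c)`. -/
theorem toReal_volume_level_add {α : Type*} [DecidableEq α] {Y : ℝ → α} {b c : ℝ} (hb : 0 ≤ b)
    (hbc : b ≤ c) {i : α} (hY : ∀ s ∈ Ico b c, Y s = i) (j : α) :
    (volume {s | s ∈ Ico 0 c ∧ Y s = j}).toReal
      = (volume {s | s ∈ Ico 0 b ∧ Y s = j}).toReal + if i = j then c - b else 0 := by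
  set A := {s | s ∈ Ico 0 c ∧ Y s = j}
  have h1 : A \ Ico b c = {s | s ∈ Ico 0 b ∧ Y s = j} := by
    ext s
    simp only [A, Set.mem_sdiff, mem_ofPred_eq, mem_Ico, not_and, not_lt]
    constructor
    · rintro ⟨⟨⟨h0, hc⟩, hj⟩, h⟩
      refine ⟨⟨h0, ?_⟩, hj⟩
      by_contra! hbs
      linarith [h hbs]
    · rintro ⟨⟨h0, hs⟩, hj⟩
      exact ⟨⟨⟨h0, hs.trans_le hbc⟩, hj⟩, fun h => absurd h (not_le.2 hs)⟩
  have h2 : volume (A ∩ Ico b c) = if i = j then ENNReal.ofReal (c - b) else 0 := by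
    split_ifs with hij
    · have : A ∩ Ico b c = Ico b c := by
        refine inter_eq_right.2 fun s hs => ⟨⟨hb.trans hs.1, hs.2⟩, ?_⟩
        rw [hY s hs, hij]
      rw [this, Real.volume_Ico]
    · have : A ∩ Ico b c = ∅ := by
        ext s
        simp only [mem_inter_iff, mem_empty_iff_false, iff_false, not_and]
        intro hA hs
        exact hij ((hY s hs).symm.trans hA.2)
      rw [this, measure_empty]
  have h3 : volume {s | s ∈ Ico 0 b ∧ Y s = j} ≠ ∞ :=
    ((measure_mono fun s hs => hs.1).trans_lt (measure_Ico_lt_top (a := 0) (b := b))).ne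
  rw [← measure_inter_add_sdiff A measurableSet_Ico, h1, h2, ENNReal.toReal_add _ h3, add_comm]
  · split_ifs
    · rw [ENNReal.toReal_ofReal (sub_nonneg.2 hbc)]
    · simp
  · split_ifs <;> simp

theorem mem_jumpEvent_of_mem_Ico {x : Fin N × Vec d} {ω : Noise N} {k : ℕ}
    (hk : (jumpChain a v x ω k).1 ≠ ∞) {s : ℝ} (hs : (jumpChain a v x ω k).1.toReal ≤ s)
    (hs' : ENNReal.ofReal s < (jumpChain a v x ω (k + 1)).1) : (x, ω) ∈ jumpEvent a v s k :=
  ⟨(ENNReal.le_ofReal_iff_toReal_le hk (ENNReal.toReal_nonneg.trans hs)).2 hs, hs'⟩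

/-- Reconciles `L`, defined by occupation times, with the positions of the chain. Intervals are
closed on the left because at a jump time `X` already has its new state. -/
theorem occupation_jumpChain {x : Fin N × Vec d} {ω : Noise N} {k : ℕ}
    (hk : (jumpChain a v x ω k).1 ≠ ∞) :
    x.2 + ∑ j, (volume {s | s ∈ Ico 0 (jumpChain a v x ω k).1.toReal ∧
        X a v x s ω = j}).toReal • v j
      = (jumpChain a v x ω k).2.2 := by
  induction k with
  | zero => simp [jumpChain]
  | succ k ih =>
    set z := jumpChain a v x ω k with hz
    set τ := hold a v z.2.1 z.2.2 (ω k) with hτ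
    have hsucc : jumpChain a v x ω (k + 1) =
        (z.1 + τ, target a v z.2.1 z.2.2 (ω k), z.2.2 + τ.toReal • v z.2.1) := rfl
    have hz_top : z.1 ≠ ∞ := fun h => hk (by simp [hsucc, h])
    have hτ_top : τ ≠ ∞ := fun h => hk (by simp [hsucc, h])
    have hT : (jumpChain a v x ω (k + 1)).1.toReal = z.1.toReal + τ.toReal := by
      rw [hsucc, ENNReal.toReal_add hz_top hτ_top]
    have hX : ∀ s ∈ Ico z.1.toReal (z.1.toReal + τ.toReal), X a v x s ω = z.2.1 := by
      intro s hs
      refine X_eq (mem_jumpEvent_of_mem_Ico hz_top hs.1 ?_)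
      rw [← ENNReal.ofReal_toReal hk, hT]
      exact (ENNReal.ofReal_lt_ofReal_iff_of_nonneg (ENNReal.toReal_nonneg.trans hs.1)).2 hs.2
    rw [hT]
    simp_rw [toReal_volume_level_add ENNReal.toReal_nonneg
      (le_add_of_nonneg_right ENNReal.toReal_nonneg) hX, add_smul]
    rw [Finset.sum_add_distrib, ← add_assoc, ih hz_top, hsucc]
    simp [ite_smul]

theorem stagePosition_jumpChain {x : Fin N × Vec d} {ω : Noise N} {t : ℝ} (ht : 0 ≤ t) {n : ℕ}
    (h : (x, ω) ∈ jumpEvent a v t n) :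
    (X a v x t ω, L a v x t ω) = stagePosition v t (jumpChain a v x ω n) := by
  have hn : (jumpChain a v x ω n).1 ≠ ∞ := (h.1.trans_lt ENNReal.ofReal_lt_top).ne
  have hle : (jumpChain a v x ω n).1.toReal ≤ t := (ENNReal.le_ofReal_iff_toReal_le hn ht).1 h.1
  have hX : ∀ s ∈ Ico (jumpChain a v x ω n).1.toReal t,
      X a v x s ω = (jumpChain a v x ω n).2.1 := fun s hs =>
    X_eq (mem_jumpEvent_of_mem_Ico hn hs.1
      ((ENNReal.ofReal_le_ofReal hs.2.le).trans_lt h.2))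
  -- Dropping the endpoint t, a null set, gives the half-open form needed for adding up intervals.
  have hocc : ∀ j, occupationTime a v x j t ω
      = (volume {s | s ∈ Ico 0 t ∧ X a v x s ω = j}).toReal := by
    intro j
    rw [occupationTime]
    congr 1
    refine measure_congr ?_
    have hne : ∀ᵐ s : ℝ, s ≠ t := by simp [ae_iff]
    filter_upwards [hne] with s hs
    apply propext
    change (s ∈ Icc 0 t ∧ _) ↔ (s ∈ Ico 0 t ∧ _)
    simp only [mem_Icc, mem_Ico, lt_iff_le_and_ne]
    tauto
  rw [stagePosition, X_eq h, L]
  simp_rw [hocc, toReal_volume_level_add ENNReal.toReal_nonneg hle hX, add_smul]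
  rw [Finset.sum_add_distrib, ← add_assoc, occupation_jumpChain hn]
  simp [ite_smul]

/-- Indispensable because `Measure.map` is zero for a map that is not a.e. measurable. On each event
of exactly n jumps the process agrees with a measurable map, and these events cover almost
everything. -/
theorem JumpRates.aemeasurable_process (ha : JumpRates a) {ρ : Measure (Fin N × Vec d)}
    [SFinite ρ] {t : ℝ} (ht : 0 ≤ t) :
    AEMeasurable (fun z : (Fin N × Vec d) × Noise N => (X a v z.1 t z.2, L a v z.1 t z.2))
      (ρ.prod (noiseLaw N)) := by
  have hrestr : (ρ.prod (noiseLaw N)).restrict (⋃ n, jumpEvent a v t n)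
      = ρ.prod (noiseLaw N) :=
    Measure.restrict_eq_self_of_ae_mem (ha.ae_exists_mem_jumpEvent ht)
  rw [← hrestr, aemeasurable_iUnion_iff]
  intro n
  refine ⟨fun q => stagePosition v t (jumpChain a v q.1 q.2 n),
    (measurable_stagePosition t).comp (ha.measurable_jumpChain n), ?_⟩
  filter_upwards [ae_restrict_mem (ha.measurableSet_jumpEvent t n)] with q hq
  exact stagePosition_jumpChain ht hq

/-- Expansion of the law of `(X t, L t)` according to the number of jumps up to time `t`. -/
theorem JumpRates.lintegral_lawAt (ha : JumpRates a) {ρ : Measure (Fin N × Vec d)}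
    [SFinite ρ] {t : ℝ} (ht : 0 ≤ t) {f : Fin N × Vec d → ℝ≥0∞} (hf : Measurable f) :
    ∫⁻ x, f x ∂lawAt a v ρ t = ∑' n, ∫⁻ x, jumpSemigroup a v n t f x ∂ρ := by
  have hG : ∀ n, Measurable fun q : (Fin N × Vec d) × Noise N =>
      f (stagePosition v t (jumpChain a v q.1 q.2 n)) := fun n =>
    hf.comp ((measurable_stagePosition t).comp (ha.measurable_jumpChain n))
  rw [lawAt, lintegral_map' hf.aemeasurable (ha.aemeasurable_process ht)]
  calc _ = ∫⁻ q in ⋃ n, jumpEvent a v t n, f (X a v q.1 t q.2, L a v q.1 t q.2)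
          ∂ρ.prod (noiseLaw N) := by
        rw [Measure.restrict_eq_self_of_ae_mem (ha.ae_exists_mem_jumpEvent ht)]
    _ = ∑' n, ∫⁻ q in jumpEvent a v t n, f (X a v q.1 t q.2, L a v q.1 t q.2)
          ∂ρ.prod (noiseLaw N) :=
        lintegral_iUnion (fun n => ha.measurableSet_jumpEvent t n)
          (pairwise_disjoint_jumpEvent t) _
    _ = _ := by
        refine tsum_congr fun n => ?_
        rw [setLIntegral_congr_fun (g := fun q => f (stagePosition v t (jumpChain a v q.1 q.2 n)))
          (ha.measurableSet_jumpEvent t n)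
          (fun q hq => congrArg f (stagePosition_jumpChain ht hq)),
          ← lintegral_indicator (ha.measurableSet_jumpEvent t n),
          lintegral_prod _ ((hG n).indicator (ha.measurableSet_jumpEvent t n)).aemeasurable]
        exact lintegral_congr fun x => ha.lintegral_jumpEvent x n ht hf

/-! ### The mild equation for densities -/

/-- The density of the flow of mass into `(j, l)` by jumps, if the mass has the density `h`. -/
def influx (a : Fin N → Fin N → Vec d → ℝ) (h : Fin N → Vec d → ℝ) (j : Fin N) (l : Vec d) : ℝ :=
  ∑ i, h i l * rate a i j l

/-- The density at `(j, l)` of the mass transported without jumps during a time `t`, plus the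
density of the mass that jumps according to `influx` and is then transported without jumps. -/
def mildDensity (a : Fin N → Fin N → Vec d → ℝ) (v : Fin N → Vec d) (h : Fin N → Vec d → ℝ)
    (j : Fin N) (t : ℝ) (l : Vec d) : ℝ :=
  h j (l - t • v j) * survival a v j (l - t • v j) t
    + ∫ s in (0 : ℝ)..t, influx a h j (l - s • v j) * survival a v j (l - s • v j) s

variable {h : Fin N → Vec d → ℝ}

theorem JumpRates.influx_nonneg (ha : JumpRates a) (h0 : ∀ j l, 0 ≤ h j l) (j : Fin N)
    (l : Vec d) : 0 ≤ influx a h j l :=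
  Finset.sum_nonneg fun i _ => mul_nonneg (h0 i l) (ha.rate_nonneg i j l)

theorem JumpRates.continuous_influx (ha : JumpRates a) (hc : ∀ j, Continuous (h j)) (j : Fin N) :
    Continuous (influx a h j) :=
  continuous_finsetSum _ fun i _ => (hc i).mul (ha.continuous_rate i j)

theorem JumpRates.continuous_survival_back (ha : JumpRates a) (j : Fin N) :
    Continuous fun q : Vec d × ℝ => survival a v j (q.1 - q.2 • v j) q.2 :=
  (ha.continuous_survival j).comp
    (f := fun q : Vec d × ℝ => (q.1 - q.2 • v j, q.2)) (by fun_prop)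

theorem JumpRates.continuous_influx_survival (ha : JumpRates a) (hc : ∀ j, Continuous (h j))
    (j : Fin N) : Continuous fun q : Vec d × ℝ =>
      influx a h j (q.1 - q.2 • v j) * survival a v j (q.1 - q.2 • v j) q.2 :=
  ((ha.continuous_influx hc j).comp (f := fun q : Vec d × ℝ => q.1 - q.2 • v j)
    (by fun_prop)).mul (ha.continuous_survival_back j)

theorem JumpRates.continuous_mildDensity (ha : JumpRates a) (hc : ∀ j, Continuous (h j))
    (j : Fin N) (t : ℝ) : Continuous (mildDensity a v h j t) := by
  unfold mildDensity
  refine Continuous.add ?_ ?_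
  · refine Continuous.mul ?_ ?_
    · exact (hc j).comp (f := fun l : Vec d => l - t • v j) (by fun_prop)
    · exact (ha.continuous_survival_back j).comp (f := fun l : Vec d => (l, t)) (by fun_prop)
  · exact intervalIntegral.continuous_parametric_intervalIntegral_of_continuous'
      (f := fun l s => influx a h j (l - s • v j) * survival a v j (l - s • v j) s)
      (ha.continuous_influx_survival hc j) 0 t

theorem JumpRates.mildDensity_nonneg (ha : JumpRates a) (h0 : ∀ j l, 0 ≤ h j l) (j : Fin N)
    {t : ℝ} (ht : 0 ≤ t) (l : Vec d) : 0 ≤ mildDensity a v h j t l :=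
  add_nonneg (mul_nonneg (h0 _ _) (survival_pos _ _ _).le)
    (intervalIntegral.integral_nonneg ht fun _ _ =>
      mul_nonneg (ha.influx_nonneg h0 _ _) (survival_pos _ _ _).le)

/-- `π` has the density `h` with respect to the product of the counting measure and Lebesgue
measure. -/
def HasDensity (π : Measure (Fin N × Vec d)) (h : Fin N → Vec d → ℝ) : Prop :=
  ∀ f : Fin N × Vec d → ℝ≥0∞, Measurable f →
    ∫⁻ x, f x ∂π = ∑ j, ∫⁻ l, ENNReal.ofReal (h j l) * f (j, l)

variable {π : Measure (Fin N × Vec d)}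

theorem lintegral_Ioc_sub_left (G : ℝ → ℝ≥0∞) (t : ℝ) :
    ∫⁻ r in Ioc 0 t, G (t - r) = ∫⁻ s in Ioc 0 t, G s := by
  rw [← lintegral_indicator measurableSet_Ioc, ← lintegral_indicator measurableSet_Ioc,
    ← lintegral_sub_left_eq_self _ t]
  have h0 : ∀ᵐ s : ℝ, s ≠ 0 := by simp [ae_iff]
  have ht : ∀ᵐ s : ℝ, s ≠ t := by simp [ae_iff]
  refine lintegral_congr_ae ?_
  filter_upwards [h0, ht] with s hs0 hst
  by_cases hs : s ∈ Ioc 0 t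
  · have hs' : t - s ∈ Ioc 0 t :=
      ⟨sub_pos.2 (lt_of_le_of_ne hs.2 hst), by linarith [hs.1]⟩
    simp [indicator_of_mem hs, indicator_of_mem hs']
  · have hs' : t - s ∉ Ioc 0 t := fun hmem =>
      hs ⟨lt_of_le_of_ne (by linarith [hmem.2]) hs0.symm, by linarith [hmem.1]⟩
    simp [indicator_of_notMem hs, indicator_of_notMem hs']

theorem JumpRates.measurable_killedOp_const (ha : JumpRates a) {f : Fin N × Vec d → ℝ≥0∞}
    (hf : Measurable f) (t : ℝ) : Measurable (killedOp a v t f) :=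
  ha.measurable_killedOp (f := fun _ => f) (hf.comp measurable_snd) measurable_const
    measurable_id

theorem JumpRates.measurable_jumpOp_const (ha : JumpRates a) {f : Fin N × Vec d → ℝ≥0∞}
    (hf : Measurable f) : Measurable (jumpOp a f) :=
  ha.measurable_jumpOp (f := fun _ => f) (hf.comp measurable_snd) measurable_id

theorem JumpRates.lintegral_killedOp (ha : JumpRates a) (hπ : HasDensity π h)
    (h0 : ∀ j l, 0 ≤ h j l) {f : Fin N × Vec d → ℝ≥0∞} (hf : Measurable f) (t : ℝ) :
    ∫⁻ x, killedOp a v t f x ∂π = ∑ j, ∫⁻ l,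
      ENNReal.ofReal (h j (l - t • v j) * survival a v j (l - t • v j) t) * f (j, l) := by
  rw [hπ _ (ha.measurable_killedOp_const hf t)]
  refine Finset.sum_congr rfl fun j _ => ?_
  rw [← lintegral_sub_right_eq_self _ (t • v j)]
  refine lintegral_congr fun l => ?_
  simp only [killedOp, sub_add_cancel]
  rw [ENNReal.ofReal_mul (h0 _ _), mul_assoc]

theorem JumpRates.lintegral_jumpOp (ha : JumpRates a) (hπ : HasDensity π h)
    (h0 : ∀ j l, 0 ≤ h j l) (hc : ∀ j, Continuous (h j)) :
    ∀ f : Fin N × Vec d → ℝ≥0∞, Measurable f → ∫⁻ x, jumpOp a f x ∂π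
      = ∑ j, ∫⁻ l, ENNReal.ofReal (influx a h j l) * f (j, l) := by
  intro f hf
  have hfm : ∀ j, Measurable fun l => f (j, l) := fun j => hf.comp measurable_prodMk_left
  rw [hπ _ (ha.measurable_jumpOp_const hf)]
  simp only [jumpOp, Finset.mul_sum]
  have hm : ∀ i j, Measurable fun l =>
      ENNReal.ofReal (h i l) * (ENNReal.ofReal (rate a i j l) * f (j, l)) := fun i j =>
    (hc i).measurable.ennreal_ofReal.mul
      ((ha.continuous_rate i j).measurable.ennreal_ofReal.mul (hfm j))
  simp_rw [lintegral_finsetSum _ fun j _ => hm _ j]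
  rw [Finset.sum_comm]
  refine Finset.sum_congr rfl fun j _ => ?_
  rw [← lintegral_finsetSum _ fun i _ => hm i j]
  refine lintegral_congr fun l => ?_
  rw [influx, ENNReal.ofReal_sum_of_nonneg fun i _ => mul_nonneg (h0 i l) (ha.rate_nonneg i j l),
    Finset.sum_mul]
  refine Finset.sum_congr rfl fun i _ => ?_
  rw [ENNReal.ofReal_mul (h0 i l), mul_assoc]

theorem JumpRates.lintegral_jumpOp_killedOp (ha : JumpRates a) (hπ : HasDensity π h)
    (h0 : ∀ j l, 0 ≤ h j l) (hc : ∀ j, Continuous (h j)) {f : Fin N × Vec d → ℝ≥0∞}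
    (hf : Measurable f) (s : ℝ) :
    ∫⁻ x, jumpOp a (killedOp a v s f) x ∂π = ∑ j, ∫⁻ l, ENNReal.ofReal
      (influx a h j (l - s • v j) * survival a v j (l - s • v j) s) * f (j, l) := by
  rw [ha.lintegral_jumpOp hπ h0 hc _ (ha.measurable_killedOp_const hf s)]
  refine Finset.sum_congr rfl fun j _ => ?_
  rw [← lintegral_sub_right_eq_self _ (s • v j)]
  refine lintegral_congr fun l => ?_
  simp only [killedOp, sub_add_cancel]
  rw [ENNReal.ofReal_mul (ha.influx_nonneg h0 _ _), mul_assoc]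

/-- Duality: translation invariance of Lebesgue measure moves the transport from f to h, after r has
been replaced by s = t - r. -/
theorem JumpRates.lintegral_mild (ha : JumpRates a) (hπ : HasDensity π h)
    (h0 : ∀ j l, 0 ≤ h j l) (hc : ∀ j, Continuous (h j)) {f : Fin N × Vec d → ℝ≥0∞}
    (hf : Measurable f) {t : ℝ} (ht : 0 ≤ t) :
    ∫⁻ x, killedOp a v t f x ∂π
        + ∫⁻ r in Ioc 0 t, ∫⁻ x, jumpOp a (killedOp a v (t - r) f) x ∂π
      = ∑ j, ∫⁻ l, ENNReal.ofReal (mildDensity a v h j t l) * f (j, l) := by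
  have hfm : ∀ j, Measurable fun l => f (j, l) := fun j => hf.comp measurable_prodMk_left
  set w : Fin N → Vec d → ℝ → ℝ := fun j l s =>
    influx a h j (l - s • v j) * survival a v j (l - s • v j) s with hw
  have hwc : ∀ j, Continuous fun q : Vec d × ℝ => w j q.1 q.2 := fun j =>
    ha.continuous_influx_survival hc j
  have hw0 : ∀ j l s, 0 ≤ w j l s := fun j l s =>
    mul_nonneg (ha.influx_nonneg h0 _ _) (survival_pos _ _ _).le
  have hm : ∀ j, Measurable fun q : ℝ × Vec d => ENNReal.ofReal (w j q.2 q.1) * f (j, q.2) :=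
    fun j => ((hwc j).measurable.comp measurable_swap).ennreal_ofReal.mul
      ((hfm j).comp measurable_snd)
  rw [lintegral_Ioc_sub_left (fun s => ∫⁻ x, jumpOp a (killedOp a v s f) x ∂π),
    ha.lintegral_killedOp hπ h0 hf]
  simp_rw [ha.lintegral_jumpOp_killedOp hπ h0 hc hf]
  rw [lintegral_finsetSum _ fun j _ => (hm j).lintegral_prod_right', ← Finset.sum_add_distrib]
  refine Finset.sum_congr rfl fun j _ => ?_
  rw [lintegral_lintegral_swap (hm j).aemeasurable, ← lintegral_add_right]
  swap
  · exact (hm j).lintegral_prod_left'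
  refine lintegral_congr fun l => ?_
  have hwl : Continuous (w j l) := (hwc j).comp (Continuous.prodMk_right l)
  dsimp only
  rw [lintegral_mul_const _ hwl.measurable.ennreal_ofReal, ← add_mul, mildDensity,
    ENNReal.ofReal_add (mul_nonneg (h0 _ _) (survival_pos _ _ _).le)
      (intervalIntegral.integral_nonneg ht fun s _ => hw0 j l s),
    intervalIntegral.integral_of_le ht, ofReal_integral_eq_lintegral_ofReal
      ((hwl.integrableOn_Icc (a := 0) (b := t)).mono_set Ioc_subset_Icc_self)
      (ae_of_all _ (hw0 j l))]

theorem JumpRates.lintegral_jumpSemigroup_succ (ha : JumpRates a) [SFinite π] (n : ℕ) {t : ℝ}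
    (ht : 0 ≤ t) {f : Fin N × Vec d → ℝ≥0∞} (hf : Measurable f) :
    ∫⁻ x, jumpSemigroup a v (n + 1) t f x ∂π
      = ∫⁻ r in Ioc 0 t, ∫⁻ x, jumpSemigroup a v n r (jumpOp a (killedOp a v (t - r) f)) x ∂π := by
  simp_rw [ha.jumpSemigroup_succ n ht hf]
  rw [lintegral_lintegral_swap]
  refine Measurable.aemeasurable ?_
  exact ha.measurable_jumpSemigroup n
    (f := fun q : (Fin N × Vec d) × ℝ => jumpOp a (killedOp a v (t - q.2) f))
    (ha.measurable_jumpOp_killedOp hf (measurable_const.sub measurable_snd))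
    measurable_snd measurable_fst

theorem JumpRates.measurable_lintegral_jumpSemigroup (ha : JumpRates a) [SFinite π] (n : ℕ)
    (t : ℝ) {f : Fin N × Vec d → ℝ≥0∞} (hf : Measurable f) :
    Measurable fun r : ℝ =>
      ∫⁻ x, jumpSemigroup a v n r (jumpOp a (killedOp a v (t - r) f)) x ∂π :=
  Measurable.lintegral_prod_right' (f := fun q : ℝ × (Fin N × Vec d) =>
    jumpSemigroup a v n q.1 (jumpOp a (killedOp a v (t - q.1) f)) q.2)
    (ha.measurable_jumpSemigroup n
      (f := fun q : ℝ × (Fin N × Vec d) => jumpOp a (killedOp a v (t - q.1) f))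
      (ha.measurable_jumpOp_killedOp hf (measurable_const.sub measurable_fst))
      measurable_fst measurable_snd)

/-- Iterating the mild identity yields only an inequality, since a remainder is discarded. Equality
of total masses repairs this. -/
theorem JumpRates.lawAt_eq_of_mildDensity_eq (ha : JumpRates a) [IsProbabilityMeasure π]
    (hπ : HasDensity π h) (h0 : ∀ j l, 0 ≤ h j l) (hc : ∀ j, Continuous (h j))
    (hmild : ∀ j l, ∀ t : ℝ, 0 ≤ t → mildDensity a v h j t l = h j l) {t : ℝ} (ht : 0 ≤ t) :
    lawAt a v π t = π := by
  have hfix : ∀ t : ℝ, 0 ≤ t → ∀ f : Fin N × Vec d → ℝ≥0∞, Measurable f →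
      ∫⁻ x, killedOp a v t f x ∂π
        + ∫⁻ r in Ioc 0 t, ∫⁻ x, jumpOp a (killedOp a v (t - r) f) x ∂π = ∫⁻ x, f x ∂π := by
    intro t ht f hf
    rw [ha.lintegral_mild hπ h0 hc hf ht, hπ f hf]
    simp_rw [fun j l => hmild j l t ht]
  -- The quantifiers over t and f stay inside the induction: the bound for n is applied at time r to
  -- B K_{t-r} f.
  have hsum : ∀ n, ∀ t : ℝ, 0 ≤ t → ∀ f : Fin N × Vec d → ℝ≥0∞, Measurable f →
      ∑ k ∈ Finset.range n, ∫⁻ x, jumpSemigroup a v k t f x ∂π ≤ ∫⁻ x, f x ∂π := by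
    intro n
    induction n with
    | zero => intro t _ f _; simp
    | succ n ih =>
      intro t ht f hf
      rw [Finset.sum_range_succ', ← hfix t ht f hf, add_comm]
      simp_rw [jumpSemigroup_zero, ha.lintegral_jumpSemigroup_succ _ ht hf]
      gcongr
      rw [← lintegral_finsetSum _ fun k _ => ha.measurable_lintegral_jumpSemigroup k t hf]
      exact setLIntegral_mono' measurableSet_Ioc fun r hr =>
        ih r hr.1.le _ (ha.measurable_jumpOp_const (ha.measurable_killedOp_const hf _))
  have hle : lawAt a v π t ≤ π := by
    refine Measure.le_iff.2 fun s hs => ?_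
    have hone : Measurable (s.indicator fun _ => (1 : ℝ≥0∞)) := measurable_const.indicator hs
    rw [← lintegral_indicator_one hs, ← lintegral_indicator_one hs]
    change ∫⁻ x, s.indicator (fun _ => (1 : ℝ≥0∞)) x ∂_ ≤ ∫⁻ x, s.indicator (fun _ => 1) x ∂_
    rw [ha.lintegral_lawAt ht hone]
    exact ENNReal.tsum_le_of_sum_range_le fun n => hsum n t ht _ hone
  have : IsProbabilityMeasure (lawAt a v π t) :=
    Measure.isProbabilityMeasure_map (ha.aemeasurable_process ht)
  exact Measure.eq_of_le_of_isProbabilityMeasure hle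

/-- In the jump expansion of π f, the terms with at least one jump sum, under the integral over the
last jump time r, to the expansion of B K_{t-r} f at time r. Invariance at r collapses it. -/
theorem JumpRates.lintegral_mild_of_isInvariant (ha : JumpRates a) [SFinite π]
    (hinv : IsInvariant a v π) {f : Fin N × Vec d → ℝ≥0∞} (hf : Measurable f) {t : ℝ}
    (ht : 0 ≤ t) :
    ∫⁻ x, f x ∂π = ∫⁻ x, killedOp a v t f x ∂π
        + ∫⁻ r in Ioc 0 t, ∫⁻ x, jumpOp a (killedOp a v (t - r) f) x ∂π := by
  have hexp : ∀ r : ℝ, 0 ≤ r → ∀ f : Fin N × Vec d → ℝ≥0∞, Measurable f →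
      ∑' n, ∫⁻ x, jumpSemigroup a v n r f x ∂π = ∫⁻ x, f x ∂π := by
    intro r hr f hf
    rw [← ha.lintegral_lawAt hr hf, hinv r hr]
  rw [← hexp t ht f hf, tsum_eq_zero_add' ENNReal.summable]
  simp_rw [jumpSemigroup_zero, ha.lintegral_jumpSemigroup_succ _ ht hf]
  rw [← lintegral_tsum fun n => (ha.measurable_lintegral_jumpSemigroup n t hf).aemeasurable]
  congr 1
  exact setLIntegral_congr_fun measurableSet_Ioc fun r hr =>
    hexp r hr.1.le _ (ha.measurable_jumpOp_const (ha.measurable_killedOp_const hf _))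

/-- Two continuous nonnegative densities of the same measure agree. -/
theorem eq_of_hasDensity {h' : Fin N → Vec d → ℝ} (hπ : HasDensity π h) (hπ' : HasDensity π h')
    (h0 : ∀ j l, 0 ≤ h j l) (h0' : ∀ j l, 0 ≤ h' j l)
    (hc : ∀ j, Continuous (h j)) (hc' : ∀ j, Continuous (h' j)) : h = h' := by
  classical
  ext j l
  have hm := (hc j).measurable.ennreal_ofReal
  have hm' := (hc' j).measurable.ennreal_ofReal
  have hset : ∀ s, MeasurableSet s → ∀ k : Fin N → Vec d → ℝ, HasDensity π k →
      ∫⁻ x, (({j} : Set (Fin N)) ×ˢ s).indicator (fun _ => 1) x ∂π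
        = ∫⁻ l in s, ENNReal.ofReal (k j l) := by
    intro s hs k hk
    rw [hk _ (measurable_const.indicator ((measurableSet_singleton j).prod hs)),
      Finset.sum_eq_single j, ← lintegral_indicator hs]
    · refine lintegral_congr fun l => ?_
      by_cases hl : l ∈ s <;> simp [indicator, hl]
    · intro i _ hij
      simp [indicator, hij]
    · simp
  have hae : (fun l => ENNReal.ofReal (h j l)) =ᵐ[volume] fun l => ENNReal.ofReal (h' j l) := by
    refine ae_eq_of_forall_setLIntegral_eq_of_sigmaFinite hm hm' fun s hs _ => ?_
    rw [← hset s hs h hπ, ← hset s hs h' hπ']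
  have heq := (Continuous.ae_eq_iff_eq volume
    (ENNReal.continuous_ofReal.comp (hc j)) (ENNReal.continuous_ofReal.comp (hc' j))).1 hae
  exact (ENNReal.ofReal_eq_ofReal_iff (h0 j l) (h0' j l)).1 (congrFun heq l)

/-- The mild form of the stationarity of a density. -/
theorem JumpRates.isInvariant_iff_mildDensity_eq (ha : JumpRates a) [IsProbabilityMeasure π]
    (hπ : HasDensity π h) (h0 : ∀ j l, 0 ≤ h j l) (hc : ∀ j, Continuous (h j)) :
    IsInvariant a v π ↔
      ∀ j l, ∀ t : ℝ, 0 ≤ t → mildDensity a v h j t l = h j l := by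
  refine ⟨fun hinv j l t ht => ?_, fun hmild t ht =>
    ha.lawAt_eq_of_mildDensity_eq hπ h0 hc hmild ht⟩
  have hden : HasDensity π fun j => mildDensity a v h j t := fun f hf => by
    rw [ha.lintegral_mild_of_isInvariant hinv hf ht, ha.lintegral_mild hπ h0 hc hf ht]
  exact (congrFun (congrFun (eq_of_hasDensity hπ hden h0
    (fun j l => ha.mildDensity_nonneg h0 j ht l) hc
    fun j => ha.continuous_mildDensity hc j t) j) l).symm

theorem hasDensity_productMeasure {p : Fin N → ℝ} (hp : ∀ j, 0 ≤ p j) {g : Vec d → ℝ}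
    (hg : Continuous g) : HasDensity (productMeasure p g) fun j l => p j * g l := by
  intro f hf
  have hgm : Measurable fun l => ENNReal.ofReal (g l) := hg.measurable.ennreal_ofReal
  have hfm : ∀ j, Measurable fun l => f (j, l) := fun j => hf.comp measurable_prodMk_left
  rw [productMeasure, lintegral_prod _ hf.aemeasurable, lintegral_finsetSum_measure]
  refine Finset.sum_congr rfl fun j _ => ?_
  rw [lintegral_smul_measure, lintegral_dirac,
    lintegral_withDensity_eq_lintegral_mul _ hgm (hfm j), smul_eq_mul,
    ← lintegral_const_mul _ (hgm.mul (hfm j))]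
  refine lintegral_congr fun l => ?_
  rw [ENNReal.ofReal_mul (hp j), Pi.mul_apply, mul_assoc]

theorem isProbabilityMeasure_productMeasure {p : Fin N → ℝ} (hp : ∀ j, 0 ≤ p j)
    (hp_sum : ∑ j, p j = 1) {g : Vec d → ℝ} (hg0 : ∀ l, 0 ≤ g l) (hg_int : ∫ l, g l = 1) :
    IsProbabilityMeasure (productMeasure p g) := by
  have h1 : IsProbabilityMeasure (∑ j, ENNReal.ofReal (p j) • Measure.dirac j) := by
    refine ⟨?_⟩
    simp [Measure.finsetSum_apply, ← ENNReal.ofReal_sum_of_nonneg fun j _ => hp j, hp_sum]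
  have h2 : IsProbabilityMeasure
      ((volume : Measure (Vec d)).withDensity fun l => ENNReal.ofReal (g l)) := by
    refine ⟨?_⟩
    have hint : Integrable g := by
      by_contra hni
      rw [integral_undef hni] at hg_int
      exact zero_ne_one hg_int
    rw [withDensity_apply _ MeasurableSet.univ, Measure.restrict_univ,
      ← ofReal_integral_eq_lintegral_ofReal hint (ae_of_all _ hg0), hg_int, ENNReal.ofReal_one]
  unfold productMeasure
  infer_instance

/-! ### Differentiability from directional derivatives -/

/-- A function with continuous derivatives in the directions of a spanning family is
differentiable. -/
theorem differentiable_of_hasDerivAt_line {E ι : Type*} [NormedAddCommGroup E] [NormedSpace ℝ E]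
    [FiniteDimensional ℝ E] [Fintype ι] {w : ι → E} (hw : Submodule.span ℝ (range w) = ⊤)
    {g : E → ℝ} {D : ι → E → ℝ} (hD : ∀ i, Continuous (D i))
    (hg : ∀ i l, HasDerivAt (fun s : ℝ => g (l + s • w i)) (D i l) 0) : Differentiable ℝ g := by
  classical
  have hline : ∀ i l s, HasDerivAt (fun s : ℝ => g (l + s • w i)) (D i (l + s • w i)) s := by
    intro i l s
    have h := hg i (l + s • w i)
    rw [← sub_self s] at h
    have := HasDerivAt.comp (h := fun r : ℝ => r - s) s h ((hasDerivAt_id s).sub_const s)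
    rw [mul_one] at this
    refine this.congr_of_eventuallyEq (Eventually.of_forall fun r => ?_)
    simp only [Function.comp]
    rw [add_assoc, ← add_smul, add_sub_cancel]
  -- Induction adds one direction at a time, as in the proof that continuous partial derivatives
  -- imply differentiability.
  have key : ∀ (S : Finset ι) (l : E), ∃ φ : (ι → ℝ) →L[ℝ] ℝ,
      HasFDerivAt (fun c : ι → ℝ => g (l + ∑ i ∈ S, c i • w i)) φ 0 := by
    intro S
    induction S using Finset.induction_on with
    | empty => intro l; exact ⟨0, by simpa using hasFDerivAt_const (g l) (0 : ι → ℝ)⟩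
    | insert k S hk ih =>
      intro l
      obtain ⟨φ, hφ⟩ := ih l
      refine ⟨φ + D k l • ContinuousLinearMap.proj k, ?_⟩
      set y : (ι → ℝ) → E := fun c => l + ∑ i ∈ S, c i • w i with hy
      have hdiff : HasFDerivAt (fun c : ι → ℝ => g (y c + c k • w k) - g (y c))
          (D k l • (ContinuousLinearMap.proj k : (ι → ℝ) →L[ℝ] ℝ)) 0 := by
        rw [hasFDerivAt_iff_isLittleO_nhds_zero, Asymptotics.isLittleO_iff]
        intro ε hε
        have hcont : ContinuousAt (fun q : (ι → ℝ) × ℝ => D k (y q.1 + q.2 • w k)) (0, 0) :=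
          ((hD k).comp (by fun_prop)).continuousAt
        obtain ⟨δ, hδ, hball⟩ := Metric.continuousAt_iff.1 hcont ε hε
        filter_upwards [Metric.ball_mem_nhds (0 : ι → ℝ) hδ] with c hc
        rw [mem_ball_zero_iff] at hc
        have hck : ‖c k‖ ≤ ‖c‖ := norm_le_pi_norm c k
        -- Subtracting the linear term s * D k l leaves a derivative of size at most ε, by
        -- continuity of D k at l.
        have hmvt := Convex.norm_image_sub_le_of_norm_hasDerivWithin_le
          (f := fun s : ℝ => g (y c + s • w k) - s * D k l)
          (f' := fun s => D k (y c + s • w k) - D k l) (C := ε) (s := uIcc 0 (c k))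
          (x := 0) (y := c k)
          (fun s _ => (((hline k (y c) s).sub ((hasDerivAt_id s).mul_const
            (D k l))).congr_deriv (by simp)).hasDerivWithinAt)
          (fun s hs => ?_) (convex_uIcc 0 (c k)) left_mem_uIcc right_mem_uIcc
        · have h2 : ε * ‖c k - 0‖ ≤ ε * ‖c‖ := by
            rw [sub_zero]; exact mul_le_mul_of_nonneg_left hck hε.le
          refine le_trans (le_of_eq ?_) (hmvt.trans h2)
          congr 1
          simp
          ring
        · have hs' : ‖s‖ ≤ ‖c k‖ := by
            have := abs_sub_left_of_mem_uIcc hs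
            simpa using this
          have hlt : dist ((c, s) : (ι → ℝ) × ℝ) (0, 0) < δ := by
            rw [dist_eq_norm, Prod.mk_sub_mk, sub_zero, sub_zero, Prod.norm_mk]
            exact max_lt hc ((hs'.trans hck).trans_lt hc)
          have := (hball hlt).le
          rw [dist_eq_norm] at this
          simpa [hy] using this
      refine (hφ.add hdiff).congr_of_eventuallyEq (Eventually.of_forall fun c => ?_)
      simp only [Pi.add_apply, hy]
      rw [Finset.sum_insert hk, add_comm (c k • w k), ← add_assoc]
      ring
  intro l
  obtain ⟨φ, hφ⟩ := key Finset.univ l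
  -- The family may be linearly dependent, so a linear right inverse of c ↦ ∑ c i • w i serves in
  -- place of coordinates.
  have hsurj : LinearMap.range (Fintype.linearCombination ℝ w) = ⊤ := by
    rw [Fintype.range_linearCombination, hw]
  obtain ⟨R, hR⟩ := LinearMap.exists_rightInverse_of_surjective _ hsurj
  have hR' : ∀ x, ∑ i, R x i • w i = x := fun x => by
    simpa [Fintype.linearCombination_apply] using LinearMap.congr_fun hR x
  have hRd : DifferentiableAt ℝ (fun x => R (x - l)) l :=
    (LinearMap.toContinuousLinearMap R).differentiableAt.comp l
      (differentiableAt_id.sub_const l)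
  have hφ' : HasFDerivAt (fun c : ι → ℝ => g (l + ∑ i, c i • w i)) φ (R (l - l)) := by
    simpa using hφ
  have := hφ'.comp l hRd.hasFDerivAt
  refine (this.congr_of_eventuallyEq (Eventually.of_forall fun x => ?_)).differentiableAt
  simp only [Function.comp, hR']
  rw [add_sub_cancel]

/-! ### The mild equation as a differential equation on lines -/

/-- Reversing time in the integral removes s from the integrand. The fundamental theorem of calculus
then applies although the rates are merely continuous. -/
theorem survival_back_eq (j : Fin N) (l : Vec d) (s : ℝ) :
    survival a v j (l - s • v j) s
      = Real.exp (-∑ i, ∫ u in (0 : ℝ)..s, rate a j i (l - u • v j)) := by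
  rw [survival]
  congr 2
  refine Finset.sum_congr rfl fun i _ => ?_
  rw [cumRate]
  have := intervalIntegral.integral_comp_sub_left (a := 0) (b := s)
    (fun u => rate a j i (l - u • v j)) s
  rw [sub_self, sub_zero] at this
  rw [← this]
  refine intervalIntegral.integral_congr fun u _ => ?_
  congr 1
  rw [sub_smul]
  abel

theorem JumpRates.hasDerivAt_survival_back (ha : JumpRates a) (j : Fin N) (l : Vec d) (s : ℝ) :
    HasDerivAt (fun s => survival a v j (l - s • v j) s)
      (-(∑ i, rate a j i (l - s • v j)) * survival a v j (l - s • v j) s) s := by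
  simp_rw [survival_back_eq]
  have hc : ∀ i, Continuous fun u : ℝ => rate a j i (l - u • v j) := fun i =>
    (ha.continuous_rate j i).comp (by fun_prop)
  have h1 : HasDerivAt (fun s => -∑ i, ∫ u in (0 : ℝ)..s, rate a j i (l - u • v j))
      (-∑ i, rate a j i (l - s • v j)) s :=
    (HasDerivAt.fun_sum fun i _ => ((hc i).integral_hasStrictDerivAt 0 s).hasDerivAt).neg
  exact h1.exp.congr_deriv (mul_comm _ _)

/-- Along the lines with direction `v j`, the mild equation is equivalent to a differential
equation. -/
theorem JumpRates.mildDensity_eq_iff (ha : JumpRates a) (hc : ∀ j, Continuous (h j))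
    (j : Fin N) :
    (∀ l, ∀ t : ℝ, 0 ≤ t → mildDensity a v h j t l = h j l) ↔
      ∀ l, HasDerivAt (fun s : ℝ => h j (l + s • v j))
        (influx a h j l - (∑ i, rate a j i l) * h j l) 0 := by
  have hI : ∀ (l : Vec d) (s : ℝ), HasDerivAt (fun t => ∫ s in (0 : ℝ)..t,
      influx a h j (l - s • v j) * survival a v j (l - s • v j) s)
      (influx a h j (l - s • v j) * survival a v j (l - s • v j) s) s := fun l s =>
    (((ha.continuous_influx_survival hc j).comp
      (Continuous.prodMk_right l)).integral_hasStrictDerivAt 0 s).hasDerivAt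
  constructor
  · intro hmild l
    -- The mild equation holds only for t ≥ 0. Looking back from y, the point l is reached at t = 1,
    -- an interior time, so a two-sided derivative is available.
    set y := l + v j with hy
    have hyl : y - (1 : ℝ) • v j = l := by rw [hy, one_smul, add_sub_cancel_right]
    set I : ℝ → ℝ := fun t => ∫ s in (0 : ℝ)..t,
      influx a h j (y - s • v j) * survival a v j (y - s • v j) s
    set S : ℝ → ℝ := fun t => survival a v j (y - t • v j) t
    have hS : S 1 ≠ 0 := (survival_pos _ _ _).ne'
    -- The mild equation at y, solved for h j (y - t • v j), gives this differentiable quotient.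
    have hquot : HasDerivAt (fun t => (h j y - I t) / S t)
        (-(influx a h j l) + (∑ i, rate a j i l) * h j l) 1 := by
      have hm := hmild y 1 zero_le_one
      have hval : h j y - I 1 = h j l * S 1 := by
        rw [mildDensity, hyl] at hm
        simp only [I, S, hyl]
        linarith
      refine (((hasDerivAt_const (1 : ℝ) (h j y)).sub (hI y 1)).div
        (ha.hasDerivAt_survival_back j y 1) hS).congr_deriv ?_
      simp only [Pi.sub_apply]
      change ((0 - influx a h j (y - (1 : ℝ) • v j) * S 1) * S 1 - (h j y - I 1) *
        (-(∑ i, rate a j i (y - (1 : ℝ) • v j)) * S 1)) / S 1 ^ 2 = _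
      rw [hval, hyl]
      field_simp
      ring
    have hback : HasDerivAt (fun t : ℝ => h j (y - t • v j))
        (-(influx a h j l) + (∑ i, rate a j i l) * h j l) 1 := by
      refine hquot.congr_of_eventuallyEq ?_
      filter_upwards [lt_mem_nhds (zero_lt_one' ℝ)] with t ht
      have := hmild y t (le_of_lt ht)
      rw [mildDensity] at this
      rw [eq_div_iff (survival_pos _ _ _).ne']
      simp only [I]
      linarith
    rw [← sub_zero (1 : ℝ)] at hback
    have := HasDerivAt.comp (h := fun s : ℝ => 1 - s) (0 : ℝ) hback
      ((hasDerivAt_id (0 : ℝ)).const_sub 1)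
    refine (this.congr_deriv (by ring)).congr_of_eventuallyEq (Eventually.of_forall fun s => ?_)
    simp only [Function.comp, hy, sub_smul, one_smul]
    congr 1
    abel
  · intro hder l t _
    have hγ : ∀ s : ℝ, HasDerivAt (fun s : ℝ => h j (l - s • v j))
        (-(influx a h j (l - s • v j) -
          (∑ i, rate a j i (l - s • v j)) * h j (l - s • v j))) s := by
      intro s
      have h1 := hder (l - s • v j)
      rw [← sub_self s] at h1
      have h2 := HasDerivAt.comp (h := fun r : ℝ => s - r) s h1 ((hasDerivAt_id s).const_sub s)
      refine (h2.congr_deriv (by ring)).congr_of_eventuallyEq (Eventually.of_forall fun r => ?_)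
      simp only [Function.comp, sub_smul]
      congr 1
      abel
    -- Under the differential equation, the loss terms from h and from survival cancel, as do the
    -- two influx terms. The constant is the value h j l at t = 0.
    have hF : ∀ s, HasDerivAt (fun t => mildDensity a v h j t l) 0 s := by
      intro s
      refine (((hγ s).mul (ha.hasDerivAt_survival_back j l s)).add (hI l s)).congr_deriv ?_
      ring
    have hconst := is_const_of_deriv_eq_zero (fun s => (hF s).differentiableAt)
      (fun s => (hF s).deriv) t 0
    rw [hconst]
    simp [mildDensity, survival_zero]

/-! ### Product densities and the conclusion -/

theorem isInvariant_productMeasure_iff (ha : JumpRates a)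
    (hv : Submodule.span ℝ (range v) = ⊤) {p : Fin N → ℝ} (hp : ∀ j, 0 < p j)
    (hp_sum : ∑ j, p j = 1) {g : Vec d → ℝ} (hg0 : ∀ l, 0 ≤ g l) (hg : Continuous g)
    (hg_int : ∫ l, g l = 1) :
    IsInvariant a v (productMeasure p g) ↔ Differentiable ℝ g ∧ ∀ j l,
      -(p j * inner ℝ (v j) (gradient g l)) +
        ∑ i with i ≠ j, (p i * a i j l * g l - p j * a j i l * g l) = 0 := by
  have hprob := isProbabilityMeasure_productMeasure (fun j => (hp j).le) hp_sum hg0 hg_int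
  set h : Fin N → Vec d → ℝ := fun j l => p j * g l with hh
  have hh0 : ∀ j l, 0 ≤ h j l := fun j l => mul_nonneg (hp j).le (hg0 l)
  have hhc : ∀ j, Continuous (h j) := fun j => continuous_const.mul hg
  rw [ha.isInvariant_iff_mildDensity_eq (hasDensity_productMeasure (fun j => (hp j).le) hg)
    hh0 hhc, forall_congr' fun j => ha.mildDensity_eq_iff hhc j]
  have hsum : ∀ j l, ∑ i with i ≠ j, (p i * a i j l * g l - p j * a j i l * g l)
      = influx a h j l - (∑ i, rate a j i l) * h j l := by
    intro j l
    rw [influx, Finset.sum_mul, ← Finset.sum_sub_distrib, Finset.sum_filter]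
    refine Finset.sum_congr rfl fun i _ => ?_
    by_cases hij : i = j
    · simp [hij, rate_self]
    · simp only [rate, hh, if_neg (Ne.symm hij), ne_eq, not_false_eq_true, if_true, hij,
        if_false]
      ring
  have hgrad : ∀ j l, inner ℝ (v j) (gradient g l) = fderiv ℝ g l (v j) := by
    intro j l
    rw [real_inner_comm, gradient, InnerProductSpace.toDual_symm_apply]
  have hline : Differentiable ℝ g → ∀ j l, HasDerivAt (fun s : ℝ => g (l + s • v j))
      (fderiv ℝ g l (v j)) 0 := fun hd j l =>
    ((hd l).hasFDerivAt.hasLineDerivAt (v j))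
  constructor
  · intro hder
    have hgd : ∀ j l, HasDerivAt (fun s : ℝ => g (l + s • v j))
        ((p j)⁻¹ * (influx a h j l - (∑ i, rate a j i l) * h j l)) 0 := by
      intro j l
      refine ((hder j l).const_mul (p j)⁻¹).congr_of_eventuallyEq
        (Eventually.of_forall fun s => ?_)
      simp only [hh]
      rw [inv_mul_cancel_left₀ (hp j).ne']
    -- The equation itself supplies continuity of the directional derivatives, as they are expressed
    -- through g and the rates.
    have hdiff : Differentiable ℝ g := by
      refine differentiable_of_hasDerivAt_line hv (fun j => ?_) hgd
      exact continuous_const.mul ((ha.continuous_influx hhc j).sub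
        ((continuous_finsetSum _ fun i _ => ha.continuous_rate j i).mul (hhc j)))
    refine ⟨hdiff, fun j l => ?_⟩
    rw [hgrad, hsum, (hline hdiff j l).unique (hgd j l), mul_inv_cancel_left₀ (hp j).ne']
    ring
  · rintro ⟨hdiff, heq⟩ j l
    refine ((hline hdiff j l).const_mul (p j)).congr_deriv ?_
    have := heq j l
    rw [hgrad, hsum] at this
    linarith

end

end InertDrift

theorem theorem1 {N d : ℕ} (hN : 1 < N) (hd : 1 ≤ d)
    (v : Fin N → EuclideanSpace ℝ (Fin d))
    (hv : Module.finrank ℝ (Submodule.span ℝ (Set.range v)) = d)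
    (a : Fin N → Fin N → EuclideanSpace ℝ (Fin d) → ℝ)
    (ha_nonneg : ∀ i j, i ≠ j → ∀ l, 0 ≤ a i j l)
    (ha_cont : ∀ i j, i ≠ j → Continuous (a i j))
    (p : Fin N → ℝ) (hp_pos : ∀ j, 0 < p j) (hp_sum : ∑ j, p j = 1)
    (g : EuclideanSpace ℝ (Fin d) → ℝ) (hg_nonneg : ∀ l, 0 ≤ g l)
    (hg_cont : Continuous g) (hg_int : ∫ l, g l = 1) :
    InertDrift.IsInvariant a v (InertDrift.productMeasure p g) ↔
      Differentiable ℝ g ∧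
        ∀ (j : Fin N) (l : EuclideanSpace ℝ (Fin d)),
          -(p j * inner ℝ (v j) (gradient g l)) +
            ∑ i with i ≠ j, (p i * a i j l * g l - p j * a j i l * g l) = 0 :=
  InertDrift.isInvariant_productMeasure_iff ⟨ha_nonneg, ha_cont⟩
    (Submodule.eq_top_of_finrank_eq (by rw [hv, finrank_euclideanSpace_fin])) hp_pos hp_sum
    hg_nonneg hg_cont hg_int
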